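/- **Resource terms.** Let $\Delta$ be the set of simple resource terms up to $\alpha$-equivalence, $s ::= x \mid \lambda x\,s \mid \langle s\rangle S$, where $S$ is a simple poly-term, i.e. a finite multiset $s_1\cdots s_k$ of simple terms ($1$ is the empty one). For $s\in\Delta$, poly-terms $S_1,\dots,S_n$ and distinct variables $x_1,\dots,x_n$, the parallel (simultaneous, capture-avoiding) differential substitution $s\langle S_1,\dots,S_n/x_1,\dots,x_n\rangle\in\mathbb N\langle\Delta\rangle$ is $0$ if for some $i$ the number of free occurrences of $x_i$ in $s$ is not the cardinality of $S_i$, and otherwise the sum, over all tuples of bijections from the elements of $S_i$ to the free occurrences of $x_i$, of the terms obtained by filling these occurrences accordingly. One-step reduction $s\to a\in\mathbb N\langle\Delta\rangle$ is the closure of $\langle\lambda x\,s\rangle S\to s\langle S/x\rangle$ under all term constructions (extended linearly); $\to^*$ on $\mathbb N\langle\Delta\rangle$ is the transitive closure of the relation that keeps or one-step reduces each summand independently. Write $t\le s$ if $s\to^* a$ for some $a$ in which $t$ occurs, and ${\uparrow}s=\{t\mid s\le t\}$. All constructions and substitution are extended to sets elementwise (a set of resource terms being a linear combination with coefficients in $\{0,1\}$,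 $1+1=1$), and for $e\subseteq\Delta$, $e^!$ is the set of finite multisets of elements of $e$. **Finiteness spaces.** For a collection $\mathcal F$ of subsets of a set $W$, $\mathcal F^\perp=\{e'\subseteq W\mid \forall e\in\mathcal F,\ e\cap e'\text{ finite}\}$. A $\Delta$-finiteness space is $X=(|X|,F(X))$ with $|X|\subseteq\Delta$, $F(X)\subseteq\mathcal P(|X|)$ and $F(X)^{\perp\perp}\subseteq F(X)$. Let $\Lambda_{fv}=(\{{\uparrow}s\mid s\in\Delta\}\cup\mathcal S)^\perp$, where $\mathcal S$ is the collection of those $e'\subseteq\Delta$ which for each finite set $\xi$ of variables have finitely many elements with all free variables in $\xi$. The space $X$ is saturated if (i) $\langle\cdots\langle x\rangle e_1^!\cdots\rangle e_k^!\in F(X)$ for every variable $x$, $k\ge0$ and $e_1,\dots,e_k\in\Lambda_{fv}$; (ii) $F(X)\subseteq\Lambda_{fv}$; (iii) for all $k\ge 0$, $g,e,e_1,\dots,e_k\in\Lambda_{fv}$ and every variable $x$, $\langle\cdots\langle g\langle e^!/x\rangle\rangle e_1^!\cdots\rangle e_k^!\in F(X)$ implies $\langle\cdots\langle\langle\lambda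 x\,g\rangle e^!\rangle e_1^!\cdots\rangle e_k^!\in F(X)$. A valuation $I$ maps type variables to saturated spaces. The types of system F are interpreted by $[[\varphi]]I=I(\varphi)$; $[[A\Rightarrow B]]I=[[A]]I\Rightarrow[[B]]I$, where $|X\Rightarrow Y|=\{t\mid\forall e\in F(X),\ \langle t\rangle e^!\in F(Y)\}$ and $F(X\Rightarrow Y)=\{g\subseteq|X\Rightarrow Y|\mid\forall e\in F(X),\ \langle g\rangle e^!\in F(Y)\}$; and $[[\forall\varphi A]]I=\bigcap_X[[A]]I[\varphi\mapsto X]$, over all saturated $X$ (intersecting both webs and collections). **Algebraic $\lambda$-terms.** Let $K$ be a field and $\Lambda_K$ the set of terms $M::=x\mid\lambda x\,M\mid (M)Q$ up to $\alpha$-equivalence, where $Q\in K\langle\Lambda_K\rangle$ is a finite formal linear combination of terms. They are typed in Curry-style system F, with the rule that $\Gamma\vdash M:A\Rightarrow B$ and $\Gamma\vdash N_i:A$ for all $i$ give $\Gamma\vdash(M)(\alpha_1N_1+\dots+\alpha_pN_p):B$. The set $\mathrm{Shape}(M)\subseteq\Delta$ is given by $\mathrm{Shape}(x)=\{x\}$,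 $\mathrm{Shape}(\lambda x\,M)=\lambda x\,\mathrm{Shape}(M)$, $\mathrm{Shape}((M)Q)=\langle\mathrm{Shape}(M)\rangle\bigl(\bigcup_{Q_N\ne0}\mathrm{Shape}(N)\bigr)^!$. If $K$ has characteristic $0$, the Taylor expansion $M^*\in K^{\Delta}$ is given by $x^*=x$, $(\lambda x\,M)^*=\lambda x\,(M^*)$, $((M)Q)^*=\sum_{k}\frac1{k!}\langle M^*\rangle(Q^*)^k$ with $Q^*=\sum_NQ_NN^*$. **Proposition.** Let $M\in\Lambda_K$ be such that $x_1:A_1,\dots,x_n:A_n\vdash M:B$. 1. For every valuation $I$ and all $e_i\in F([[A_i]]I)$ $(1\le i\le n)$, $$\mathrm{Shape}(M)\langle e_1^!,\dots,e_n^!/x_1,\dots,x_n\rangle\in F([[B]]I).$$ 2. If $K$ has characteristic $0$, then $M^*\in K\langle\Lambda_{fv}\rangle$, that is, the support of $M^*$ belongs to $\Lambda_{fv}$. Consequently $M^*$ can be reduced without creating infinite coefficients: whatever the choice, for each $s$ with $M^*_s\neq0$, of $a_s\in\mathbb N\langle\Delta\rangle$ such that $s\to^* a_s$, each $t\in\Delta$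 occurs in $a_s$ for only finitely many $s$ with $M^*_s\ne0$, and the sum $\sum_sM^*_s\,a_s$, which is thus well defined, again belongs to $K\langle\Lambda_{fv}\rangle$. -/

import Mathlib

open scoped Classical

universe u

noncomputable section

/-! ## Simple resource terms and poly-terms

Terms are taken up to alpha-equivalence, in de Bruijn style: variables are natural numbers, an
abstraction binds the variable `0` of its body.  A simple poly-term is a finite multiset of simple
terms.  The set of simple terms is the initial algebra of
`α ↦ ℕ + α + α × Multiset α`, built with Mathlib's fixed points of quotients of polynomial
functors (an inductive type cannot be nested through the quotient `Multiset`). -/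

/-- One layer of a simple term over `α`. -/
inductive ResF (α : Type) : Type
  | var (x : ℕ) : ResF α
  | lam (s : α) : ResF α
  | app (s : α) (S : Multiset α) : ResF α

/-- Shapes of the polynomial functor that `ResF` is a quotient of. -/
inductive ResShape : Type
  | var (x : ℕ) : ResShape
  | lam : ResShape
  | app (n : ℕ) : ResShape

/-- Positions of a shape. -/
def ResShape.Pos : ResShape → Type
  | .var _ => Empty
  | .lam => Unit
  | .app n => Option (Fin n)

/-- Functorial action of one layer. -/
def ResF.map {α β : Type} (f : α → β) : ResF α → ResF β
  | .var x => .var x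
  | .lam s => .lam (f s)
  | .app s S => .app (f s) (S.map f)

instance : Functor ResF where
  map := ResF.map

/-- Forget the order of the arguments. -/
def ResF.abs {α : Type} : (⟨ResShape, ResShape.Pos⟩ : PFunctor.{0, 0}) α → ResF α
  | ⟨.var x, _⟩ => .var x
  | ⟨.lam, v⟩ => .lam (v ())
  | ⟨.app n, v⟩ =>
    .app (v (none : Option (Fin n)))
      (Multiset.map (fun i : Fin n => v (some i : Option (Fin n))) Finset.univ.val)

theorem ResF.abs_surjective {α : Type} (x : ResF α) : ∃ p, ResF.abs p = x := by
  cases x with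
  | var x => exact ⟨⟨.var x, fun e => nomatch e⟩, rfl⟩
  | lam s => exact ⟨⟨.lam, fun _ => s⟩, rfl⟩
  | app s S =>
    induction S using Quotient.inductionOn with
    | h l =>
      refine ⟨⟨.app l.length, fun o : Option (Fin l.length) => o.elim s l.get⟩, ?_⟩
      have h : Multiset.map l.get (Finset.univ : Finset (Fin l.length)).val
          = (l : Multiset α) := by
        rw [Fin.univ_val_map, List.ofFn_get]
      exact congrArg (ResF.app s) h

instance : QPF ResF where
  P := ⟨ResShape, ResShape.Pos⟩
  abs := ResF.abs
  repr := fun x => (ResF.abs_surjective x).choose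
  abs_repr := fun x => (ResF.abs_surjective x).choose_spec
  abs_map := by
    rintro α β f ⟨a, v⟩
    cases a with
    | var x => rfl
    | lam => rfl
    | app n => exact congrArg (ResF.app _) (Multiset.map_map f _ _).symm

/-- Simple resource terms. -/
def RTerm : Type := QPF.Fix ResF

/-- Simple poly-terms: finite multisets of simple terms. -/
abbrev RPoly : Type := Multiset RTerm

namespace RTerm

/-- A variable. -/
def var (x : ℕ) : RTerm := QPF.Fix.mk (F := ResF) (ResF.var x)

/-- Abstraction, binding the variable `0`. -/
def lam (s : RTerm) : RTerm := QPF.Fix.mk (F := ResF) (ResF.lam s)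

/-- Application `⟨s⟩S` of a simple term to a simple poly-term. -/
def app (s : RTerm) (S : RPoly) : RTerm := QPF.Fix.mk (F := ResF) (ResF.app s S)

/-- The outermost layer of a simple term. -/
def dest (s : RTerm) : ResF RTerm := QPF.Fix.dest (F := ResF) s

/-- Structural recursion on simple terms. -/
def fold {α : Type} (g : ResF α → α) (s : RTerm) : α := QPF.Fix.rec (F := ResF) g s

theorem fold_var {α : Type} (g : ResF α → α) (x : ℕ) : fold g (var x) = g (.var x) :=
  QPF.Fix.rec_eq (F := ResF) g _

theorem fold_lam {α : Type} (g : ResF α → α) (s : RTerm) :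
    fold g (lam s) = g (.lam (fold g s)) :=
  QPF.Fix.rec_eq (F := ResF) g _

theorem fold_app {α : Type} (g : ResF α → α) (s : RTerm) (S : RPoly) :
    fold g (app s S) = g (.app (fold g s) (S.map (fold g))) :=
  QPF.Fix.rec_eq (F := ResF) g _

@[simp] theorem dest_var (x : ℕ) : dest (var x) = .var x := QPF.Fix.dest_mk (F := ResF) _

@[simp] theorem dest_lam (s : RTerm) : dest (lam s) = .lam s := QPF.Fix.dest_mk (F := ResF) _

@[simp] theorem dest_app (s : RTerm) (S : RPoly) : dest (app s S) = .app s S :=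
  QPF.Fix.dest_mk (F := ResF) _

theorem ind {p : RTerm → Prop} (hvar : ∀ x, p (var x)) (hlam : ∀ s, p s → p (lam s))
    (happ : ∀ s S, p s → (∀ t ∈ S, p t) → p (app s S)) (s : RTerm) : p s := by
  refine QPF.Fix.ind (F := ResF) p ?_ s
  rintro x ⟨y, rfl⟩
  cases y with
  | var x => exact hvar x
  | lam t => exact hlam _ t.2
  | app t T =>
    refine happ _ _ t.2 ?_
    intro v hv
    obtain ⟨w, _, rfl⟩ := Multiset.mem_map.1 hv
    exact w.2

/-! ### Renaming and free variables -/

/-- Extend a renaming under a binder. -/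
def liftRen (f : ℕ → ℕ) : ℕ → ℕ
  | 0 => 0
  | k + 1 => f k + 1

/-- Renaming of the free variables. -/
def rename (s : RTerm) (f : ℕ → ℕ) : RTerm :=
  fold (α := (ℕ → ℕ) → RTerm)
    (fun
      | .var x => fun f => var (f x)
      | .lam r => fun f => lam (r (liftRen f))
      | .app r R => fun f => app (r f) (R.map fun q => q f)) s f

@[simp] theorem rename_var (x : ℕ) (f : ℕ → ℕ) : rename (var x) f = var (f x) := by
  simp only [rename, fold_var]

@[simp] theorem rename_lam (s : RTerm) (f : ℕ → ℕ) :
    rename (lam s) f = lam (rename s (liftRen f)) := by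
  simp only [rename, fold_lam]

@[simp] theorem rename_app (s : RTerm) (S : RPoly) (f : ℕ → ℕ) :
    rename (app s S) f = app (rename s f) (S.map fun t => rename t f) := by
  simp only [rename, fold_app, Multiset.map_map, Function.comp_def]

/-- The set of free variables. -/
def fv (s : RTerm) : Set ℕ :=
  fold (α := Set ℕ)
    (fun
      | .var x => {x}
      | .lam r => {k | k + 1 ∈ r}
      | .app r R => {k | k ∈ r ∨ ∃ q ∈ R, k ∈ q}) s

@[simp] theorem fv_var (x : ℕ) : fv (var x) = {x} := by
  simp only [fv, fold_var]

@[simp] theorem fv_lam (s : RTerm) : fv (lam s) = {k | k + 1 ∈ fv s} := by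
  simp only [fv, fold_lam]

@[simp] theorem fv_app (s : RTerm) (S : RPoly) :
    fv (app s S) = {k | k ∈ fv s ∨ ∃ t ∈ S, k ∈ fv t} := by
  ext k
  simp [fv, fold_app]

/-! ### Differential substitution

`plug s c` lists (with multiplicities) all the ways of replacing, independently, each free
occurrence of each variable `x` of `s` by one of the candidates `c x`.  Each candidate carries a
multiset of labels in `L`, and the labels used in a replacement are collected. -/

/-- Extend a candidate environment under a binder. -/
def liftCand {L : Type} (c : ℕ → Multiset (RTerm × Multiset L)) :
    ℕ → Multiset (RTerm × Multiset L)
  | 0 => {(var 0, 0)}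
  | k + 1 => (c k).map fun p => (rename p.1 Nat.succ, p.2)

/-- All ways of replacing each free variable occurrence by one of its candidates. -/
def plug {L : Type} (s : RTerm) (c : ℕ → Multiset (RTerm × Multiset L)) :
    Multiset (RTerm × Multiset L) :=
  fold (α := (ℕ → Multiset (RTerm × Multiset L)) → Multiset (RTerm × Multiset L))
    (fun
      | .var x => fun c => c x
      | .lam r => fun c => (r (liftCand c)).map fun p => (lam p.1, p.2)
      | .app r R => fun c =>
        (r c ×ˢ (R.map fun q => q c).Sections).map fun p =>
          (app p.1.1 (p.2.map Prod.fst), p.1.2 + (p.2.map Prod.snd).sum)) s c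

@[simp] theorem plug_var {L : Type} (x : ℕ) (c : ℕ → Multiset (RTerm × Multiset L)) :
    plug (var x) c = c x := by
  simp only [plug, fold_var]

@[simp] theorem plug_lam {L : Type} (s : RTerm) (c : ℕ → Multiset (RTerm × Multiset L)) :
    plug (lam s) c = (plug s (liftCand c)).map fun p => (lam p.1, p.2) := by
  simp only [plug, fold_lam]

@[simp] theorem plug_app {L : Type} (s : RTerm) (S : RPoly)
    (c : ℕ → Multiset (RTerm × Multiset L)) :
    plug (app s S) c =
      (plug s c ×ˢ (S.map fun t => plug t c).Sections).map fun p =>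
        (app p.1.1 (p.2.map Prod.fst), p.1.2 + (p.2.map Prod.snd).sum) := by
  simp only [plug, fold_app, Multiset.map_map, Function.comp_def]

/-- The elements of `S 0, …, S (n-1)`, counted with multiplicity. -/
abbrev Label {n : ℕ} (S : Fin n → RPoly) : Type := Σ i : Fin n, (S i).ToType

/-- The candidates for parallel substitution: those for `x < n` are the elements of `S x`;
the variable `n + k` becomes the variable `k`. -/
def candidates {n : ℕ} (S : Fin n → RPoly) (x : ℕ) : Multiset (RTerm × Multiset (Label S)) :=
  if h : x < n then
    (Finset.univ : Finset (S ⟨x, h⟩).ToType).val.map fun l => (l.1, {⟨⟨x, h⟩, l⟩})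
  else {(var (x - n), 0)}

/-- Parallel differential substitution `s⟨S 0, …, S (n-1) / 0, …, n-1⟩`, a finite linear
combination of simple terms with coefficients in `ℕ`, that is, a finite multiset: the sum over all
ways of filling the free occurrences of the variables `i < n` with the elements of `S i` in which
each element of each `S i` is used exactly once.  (It is `0` if for some `i` the number of
occurrences differs from the cardinality of `S i`.) -/
def msubst {n : ℕ} (s : RTerm) (S : Fin n → RPoly) : Multiset RTerm :=
  ((plug s (candidates S)).filter
    fun p => p.2 = (Finset.univ : Finset (Label S)).val).map Prod.fst

/-! ### Reduction -/

/-- One step reduction of a simple term to a finite `ℕ`-linear combination of simple terms. -/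
inductive Step : RTerm → Multiset RTerm → Prop
  | lam {s : RTerm} {a : Multiset RTerm} : Step s a → Step (lam s) (a.map lam)
  | appL {s : RTerm} {a : Multiset RTerm} (S : RPoly) :
      Step s a → Step (app s S) (a.map fun t => app t S)
  | appR (s : RTerm) {u : RTerm} {b : Multiset RTerm} (S : RPoly) :
      Step u b → Step (app s (u ::ₘ S)) (b.map fun t => app s (t ::ₘ S))
  | beta (s : RTerm) (S : RPoly) : Step (app (lam s) S) (msubst s fun _ : Fin 1 => S)

/-- One parallel step on finite `ℕ`-linear combinations: each summand, independently, is kept or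
reduced by one step. -/
def ParStep (a b : Multiset RTerm) : Prop :=
  ∃ l : Multiset (RTerm × Multiset RTerm),
    (∀ p ∈ l, p.2 = {p.1} ∨ Step p.1 p.2) ∧ l.map Prod.fst = a ∧ (l.map Prod.snd).sum = b

/-- Reduction of finite `ℕ`-linear combinations. -/
def Red : Multiset RTerm → Multiset RTerm → Prop := Relation.TransGen ParStep

/-- `Below t s` is the order relation `t ≤ s` on simple terms: `t` occurs in some reduct of `s`. -/
def Below (t s : RTerm) : Prop := ∃ a : Multiset RTerm, Red {s} a ∧ t ∈ a

/-- The set of all terms above `s`. -/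
def up (s : RTerm) : Set RTerm := {t | Below s t}

end RTerm

open RTerm

/-! ## Sets of simple terms -/

/-- `e^!`: the poly-terms all of whose elements are in `e`. -/
def prom (e : Set RTerm) : Set RPoly := {S | ∀ s ∈ S, s ∈ e}

/-- `λ g`. -/
def lamSet (g : Set RTerm) : Set RTerm := lam '' g

/-- `⟨g⟩E`. -/
def appSet (g : Set RTerm) (E : Set RPoly) : Set RTerm := Set.image2 app g E

/-- `⟨…⟨⟨g⟩e₁^!⟩…⟩eₖ^!`. -/
def appsSet (g : Set RTerm) (es : List (Set RTerm)) : Set RTerm :=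
  es.foldl (fun h e => appSet h (prom e)) g

/-- Parallel differential substitution of sets of poly-terms in a set of simple terms. -/
def msubstSet {n : ℕ} (f : Set RTerm) (E : Fin n → Set RPoly) : Set RTerm :=
  {t | ∃ s ∈ f, ∃ S : Fin n → RPoly, (∀ i, S i ∈ E i) ∧ t ∈ msubst s S}

/-! ## Finiteness structures -/

/-- Orthogonal of a collection of subsets of `W`. -/
def orth {α : Type} (W : Set α) (F : Set (Set α)) : Set (Set α) :=
  {e' | e' ⊆ W ∧ ∀ e ∈ F, (e ∩ e').Finite}

/-- The basic finiteness structure on simple terms. -/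
def Nfin : Set (Set RTerm) := orth Set.univ (Set.range up)

/-- Sets having only finitely many elements with free variables in any given finite set. -/
def fvThin : Set (Set RTerm) :=
  {e' | ∀ ξ : Finset ℕ, {s ∈ e' | fv s ⊆ (ξ : Set ℕ)}.Finite}

/-- The basic finiteness structure with control on free variables. -/
def Nfv : Set (Set RTerm) := Nfin ∩ orth Set.univ fvThin

/-- A set of simple terms with a collection of subsets. -/
structure ResSpace : Type where
  web : Set RTerm
  fin : Set (Set RTerm)

namespace ResSpace

/-- `X` is a finiteness space (whose web is a set of simple terms). -/
def IsFinitenessSpace (X : ResSpace) : Prop :=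
  (∀ e ∈ X.fin, e ⊆ X.web) ∧ orth X.web (orth X.web X.fin) ⊆ X.fin

/-- The sets `⟨…⟨x⟩e₁^!…⟩eₖ^!` with `x` a variable and `e₁, …, eₖ` in `Nfv`. -/
def varSets : Set (Set RTerm) :=
  {f | ∃ (x : ℕ) (es : List (Set RTerm)), (∀ e ∈ es, e ∈ Nfv) ∧ f = appsSet {var x} es}

/-- Saturated finiteness spaces. -/
structure IsSaturated (X : ResSpace) : Prop where
  isFinitenessSpace : X.IsFinitenessSpace
  varSets_subset : varSets ⊆ X.fin
  subset_nfv : X.fin ⊆ Nfv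
  expansion : ∀ g ∈ Nfv, ∀ e ∈ Nfv, ∀ es : List (Set RTerm), (∀ e' ∈ es, e' ∈ Nfv) →
    appsSet (msubstSet g fun _ : Fin 1 => prom e) es ∈ X.fin →
    appsSet (appSet (lamSet g) (prom e)) es ∈ X.fin

/-- The space `X ⇒ Y`. -/
def impl (X Y : ResSpace) : ResSpace where
  web := {t | ∀ e ∈ X.fin, appSet {t} (prom e) ∈ Y.fin}
  fin := {g | g ⊆ {t | ∀ e ∈ X.fin, appSet {t} (prom e) ∈ Y.fin} ∧
    ∀ e ∈ X.fin, appSet g (prom e) ∈ Y.fin}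

/-- Intersection of the spaces `F X`, for `X` ranging over all saturated finiteness spaces. -/
def interSat (F : ResSpace → ResSpace) : ResSpace where
  web := {t | ∀ X : ResSpace, X.IsSaturated → t ∈ (F X).web}
  fin := {e | ∀ X : ResSpace, X.IsSaturated → e ∈ (F X).fin ∧ e ⊆ (F X).web}

end ResSpace

/-! ## Types of system F -/

/-- Types of system F, in de Bruijn style: `all A` binds the type variable `0` of `A`. -/
inductive Ty : Type
  | var (i : ℕ) : Ty
  | impl (A B : Ty) : Ty
  | all (A : Ty) : Ty

/-- Push a value in front of a sequence. -/
def scons {α : Type} (a : α) (f : ℕ → α) : ℕ → α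
  | 0 => a
  | k + 1 => f k

namespace Ty

/-- Renaming of the free type variables. -/
def rename : Ty → (ℕ → ℕ) → Ty
  | var i, f => var (f i)
  | impl A B, f => impl (A.rename f) (B.rename f)
  | all A, f => all (A.rename (scons 0 fun i => f i + 1))

/-- Capture-avoiding parallel substitution of types for type variables. -/
def subst : Ty → (ℕ → Ty) → Ty
  | var i, σ => σ i
  | impl A B, σ => impl (A.subst σ) (B.subst σ)
  | all A, σ => all (A.subst (scons (var 0) fun i => (σ i).rename Nat.succ))

/-- `A[B/0]`, the other type variables being shifted down. -/
def inst (A B : Ty) : Ty := A.subst (scons B var)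

/-- The interpretation of a type in a valuation. -/
def sem : Ty → (ℕ → ResSpace) → ResSpace
  | var i, I => I i
  | impl A B, I => (A.sem I).impl (B.sem I)
  | all A, I => ResSpace.interSat fun X => A.sem (scons X I)

end Ty

/-! ## Algebraic lambda-terms

The set of algebraic lambda-terms is the initial algebra of `α ↦ ℕ + α + α × K⟨α⟩`, where `K⟨α⟩`
is the free `K`-module on `α`. -/

/-- One layer of an algebraic lambda-term over `α`. -/
inductive AlgF (K : Type u) [Field K] (α : Type u) : Type u
  | var (x : ℕ) : AlgF K α
  | lam (M : α) : AlgF K α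
  | app (M : α) (Q : α →₀ K) : AlgF K α

/-- Shapes of the polynomial functor that `AlgF` is a quotient of. -/
inductive AlgShape (K : Type u) : Type u
  | var (x : ℕ) : AlgShape K
  | lam : AlgShape K
  | app (n : ℕ) (c : Fin n → K) : AlgShape K

/-- Positions of a shape. -/
def AlgShape.Pos {K : Type u} : AlgShape K → Type u
  | .var _ => PEmpty
  | .lam => PUnit
  | .app n _ => ULift (Option (Fin n))

/-- Functorial action of one layer (linear on the free module). -/
def AlgF.map {K : Type u} [Field K] {α β : Type u} (f : α → β) : AlgF K α → AlgF K β
  | .var x => .var x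
  | .lam M => .lam (f M)
  | .app M Q => .app (f M) (Q.mapDomain f)

instance (K : Type u) [Field K] : Functor (AlgF K) where
  map := AlgF.map

/-- Evaluate formal sums `c₁ N₁ + ⋯ + cₙ Nₙ` in the free module. -/
def AlgF.abs {K : Type u} [Field K] {α : Type u} :
    (⟨AlgShape K, AlgShape.Pos⟩ : PFunctor.{u, u}) α → AlgF K α
  | ⟨.var x, _⟩ => .var x
  | ⟨.lam, v⟩ => .lam (v PUnit.unit)
  | ⟨.app n c, v⟩ =>
    .app (v (ULift.up (none : Option (Fin n))))
      (∑ i : Fin n, Finsupp.single (v (ULift.up (some i : Option (Fin n)))) (c i))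

theorem AlgF.abs_surjective {K : Type u} [Field K] {α : Type u} (x : AlgF K α) :
    ∃ p, AlgF.abs p = x := by
  cases x with
  | var x => exact ⟨⟨.var x, fun e => nomatch e⟩, rfl⟩
  | lam s => exact ⟨⟨.lam, fun _ => s⟩, rfl⟩
  | app M Q =>
    let l := Q.support.toList
    refine ⟨⟨.app l.length fun i => Q (l.get i),
      fun o : ULift (Option (Fin l.length)) => o.down.elim M l.get⟩, ?_⟩
    have h : ∑ i : Fin l.length, Finsupp.single (l.get i) (Q (l.get i)) = Q := by
      conv_rhs => rw [← Finsupp.sum_single Q]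
      rw [Finsupp.sum, ← Finset.sum_map_toList Q.support, ← List.sum_ofFn]
      congr 1
      exact (List.ofFn_getElem_eq_map l fun a => Finsupp.single a (Q a))
    exact congrArg (AlgF.app M) h

instance (K : Type u) [Field K] : QPF (AlgF K) where
  P := ⟨AlgShape K, AlgShape.Pos⟩
  abs := AlgF.abs
  repr := fun x => (AlgF.abs_surjective x).choose
  abs_repr := fun x => (AlgF.abs_surjective x).choose_spec
  abs_map := by
    rintro α β f ⟨a, v⟩
    cases a with
    | var x => rfl
    | lam => rfl
    | app n c =>
      refine congrArg (AlgF.app _) ?_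
      rw [Finsupp.mapDomain_finsetSum]
      simp only [Finsupp.mapDomain_single]
      rfl

/-- Algebraic lambda-terms with coefficients in `K`. -/
def AlgTerm (K : Type u) [Field K] : Type u := QPF.Fix (AlgF K)

namespace AlgTerm

variable {K : Type u} [Field K]

/-- A variable. -/
def var (x : ℕ) : AlgTerm K := QPF.Fix.mk (F := AlgF K) (AlgF.var x)

/-- Abstraction, binding the variable `0`. -/
def lam (M : AlgTerm K) : AlgTerm K := QPF.Fix.mk (F := AlgF K) (AlgF.lam M)

/-- Application of a term to a finite linear combination of terms. -/
def app (M : AlgTerm K) (Q : AlgTerm K →₀ K) : AlgTerm K :=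
  QPF.Fix.mk (F := AlgF K) (AlgF.app M Q)

/-- The outermost layer of an algebraic lambda-term. -/
def dest (M : AlgTerm K) : AlgF K (AlgTerm K) := QPF.Fix.dest (F := AlgF K) M

@[simp] theorem dest_var (x : ℕ) : dest (var x : AlgTerm K) = .var x :=
  QPF.Fix.dest_mk (F := AlgF K) _

@[simp] theorem dest_lam (M : AlgTerm K) : dest (lam M) = .lam M :=
  QPF.Fix.dest_mk (F := AlgF K) _

@[simp] theorem dest_app (M : AlgTerm K) (Q : AlgTerm K →₀ K) : dest (app M Q) = .app M Q :=
  QPF.Fix.dest_mk (F := AlgF K) _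

theorem ind {p : AlgTerm K → Prop} (hvar : ∀ x, p (var x)) (hlam : ∀ M, p M → p (lam M))
    (happ : ∀ M Q, p M → (∀ N ∈ Q.support, p N) → p (app M Q)) (M : AlgTerm K) : p M := by
  refine QPF.Fix.ind (F := AlgF K) p ?_ M
  rintro x ⟨y, rfl⟩
  cases y with
  | var x => exact hvar x
  | lam t => exact hlam _ t.2
  | app t T =>
    refine happ _ _ t.2 ?_
    intro v hv
    obtain ⟨w, _, rfl⟩ := Finset.mem_image.1 (Finsupp.mapDomain_support hv)
    exact w.2

/-- Structural recursion on algebraic lambda-terms. -/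
def fold {α : Type u} (g : AlgF K α → α) (M : AlgTerm K) : α := QPF.Fix.rec (F := AlgF K) g M

theorem fold_var {α : Type u} (g : AlgF K α → α) (x : ℕ) : fold g (var x) = g (.var x) :=
  QPF.Fix.rec_eq (F := AlgF K) g _

theorem fold_lam {α : Type u} (g : AlgF K α → α) (M : AlgTerm K) :
    fold g (lam M) = g (.lam (fold g M)) :=
  QPF.Fix.rec_eq (F := AlgF K) g _

theorem fold_app {α : Type u} (g : AlgF K α → α) (M : AlgTerm K) (Q : AlgTerm K →₀ K) :
    fold g (app M Q) = g (.app (fold g M) (Q.mapDomain (fold g))) :=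
  QPF.Fix.rec_eq (F := AlgF K) g _

/-- Typing in system F, Curry style.  The context `Γ` gives types to the variables
`0, …, n - 1`.  In the rule for generalization the context is shifted, which says that the
generalized type variable is not free in it. -/
inductive Typed : {n : ℕ} → (Fin n → Ty) → AlgTerm K → Ty → Prop
  | var {n : ℕ} (Γ : Fin n → Ty) (i : Fin n) : Typed Γ (var i) (Γ i)
  | lam {n : ℕ} {Γ : Fin n → Ty} {M : AlgTerm K} {A B : Ty} :
      Typed (Fin.cons (α := fun _ => Ty) A Γ) M B → Typed Γ (lam M) (A.impl B)
  | app {n : ℕ} {Γ : Fin n → Ty} {M : AlgTerm K} {Q : AlgTerm K →₀ K} {A B : Ty} :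
      Typed Γ M (A.impl B) → (∀ N ∈ Q.support, Typed Γ N A) → Typed Γ (app M Q) B
  | inst {n : ℕ} {Γ : Fin n → Ty} {M : AlgTerm K} {A : Ty} (B : Ty) :
      Typed Γ M A.all → Typed Γ M (A.inst B)
  | gen {n : ℕ} {Γ : Fin n → Ty} {M : AlgTerm K} {A : Ty} :
      Typed (fun i => (Γ i).rename Nat.succ) M A → Typed Γ M A.all

/-- `InShape M s` says that the simple term `s` has the shape of `M`: each argument of `M` is
replaced by an arbitrary multiset of terms which have the shape of one of its summands. -/
inductive InShape : AlgTerm K → RTerm → Prop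
  | var (x : ℕ) : InShape (var x) (RTerm.var x)
  | lam {M : AlgTerm K} {s : RTerm} : InShape M s → InShape (lam M) (RTerm.lam s)
  | app_zero {M : AlgTerm K} {s : RTerm} (Q : AlgTerm K →₀ K) :
      InShape M s → InShape (app M Q) (RTerm.app s 0)
  | app_cons {M N : AlgTerm K} {Q : AlgTerm K →₀ K} {s t : RTerm} {T : RPoly} :
      InShape (app M Q) (RTerm.app s T) → N ∈ Q.support → InShape N t →
      InShape (app M Q) (RTerm.app s (t ::ₘ T))

/-- The set of all simple terms which have the shape of `M`. -/
def shape (M : AlgTerm K) : Set RTerm := {s | InShape M s}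

theorem inShape_dest {M : AlgTerm K} {s : RTerm} (h : InShape M s) :
    match M.dest with
    | .var x => s = RTerm.var x
    | .lam N => ∃ t, InShape N t ∧ s = RTerm.lam t
    | .app N Q => ∃ t T, InShape N t ∧ (∀ u ∈ T, ∃ L ∈ Q.support, InShape L u) ∧
        s = RTerm.app t T := by
  induction h with
  | var x => simp
  | lam h _ => rw [dest_lam]; exact ⟨_, h, rfl⟩
  | app_zero Q h _ => rw [dest_app]; exact ⟨_, 0, h, by simp, rfl⟩
  | app_cons h hN ht ih _ =>
    rw [dest_app] at ih ⊢
    obtain ⟨t', T', h1, h2, h3⟩ := ih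
    have h4 := congrArg RTerm.dest h3
    simp only [RTerm.dest_app, ResF.app.injEq] at h4
    obtain ⟨rfl, rfl⟩ := h4
    refine ⟨_, _, h1, ?_, rfl⟩
    intro u hu
    rcases Multiset.mem_cons.1 hu with rfl | hu
    · exact ⟨_, hN, ht⟩
    · exact h2 u hu

theorem shape_var (x : ℕ) : shape (var x : AlgTerm K) = {RTerm.var x} := by
  ext s
  constructor
  · intro h
    have := inShape_dest h
    simpa using this
  · rintro rfl
    exact InShape.var x

theorem shape_lam (M : AlgTerm K) : shape (lam M) = lamSet (shape M) := by
  ext s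
  constructor
  · intro h
    have := inShape_dest h
    rw [dest_lam] at this
    obtain ⟨t, h1, rfl⟩ := this
    exact ⟨t, h1, rfl⟩
  · rintro ⟨t, h, rfl⟩
    exact InShape.lam h

theorem shape_app (M : AlgTerm K) (Q : AlgTerm K →₀ K) :
    shape (app M Q) = appSet (shape M) (prom (⋃ N ∈ Q.support, shape N)) := by
  ext s
  constructor
  · intro h
    have := inShape_dest h
    rw [dest_app] at this
    obtain ⟨t, T, h1, h2, rfl⟩ := this
    exact ⟨t, h1, T, fun u hu => by simpa [shape] using h2 u hu, rfl⟩
  · rintro ⟨t, h, T, hT, rfl⟩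
    induction T using Multiset.induction_on with
    | empty => exact InShape.app_zero Q h
    | cons u T ih =>
      have hu := hT u (Multiset.mem_cons_self u T)
      simp only [Set.mem_iUnion, exists_prop] at hu
      obtain ⟨N, hN, hu⟩ := hu
      exact InShape.app_cons (ih fun v hv => hT v (Multiset.mem_cons_of_mem hv)) hN hu

/-- One step of the recursive computation of the Taylor coefficients. -/
def taylorStep : AlgF K (RTerm → K) → RTerm → K
  | .var x, s => if s = RTerm.var x then 1 else 0
  | .lam a, s =>
    match s.dest with
    | .lam t => a t
    | _ => 0
  | .app a Q, s =>
    match s.dest with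
    | .app t T =>
      a t * ∏ v ∈ T.toFinset,
        (Q.sum fun b c => c * b v) ^ T.count v / ((T.count v).factorial : K)
    | _ => 0

/-- The Taylor expansion of an algebraic lambda-term, as the family of its coefficients. -/
def taylor (M : AlgTerm K) : RTerm → K := fold taylorStep M

theorem taylor_var (x : ℕ) (s : RTerm) :
    taylor (var x : AlgTerm K) s = if s = RTerm.var x then 1 else 0 := by
  simp only [taylor, fold_var, taylorStep]

theorem taylor_lam_lam (M : AlgTerm K) (t : RTerm) :
    taylor (lam M) (RTerm.lam t) = taylor M t := by
  simp only [taylor, fold_lam, taylorStep, RTerm.dest_lam]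

theorem taylor_app_app (M : AlgTerm K) (Q : AlgTerm K →₀ K) (t : RTerm) (T : RPoly) :
    taylor (app M Q) (RTerm.app t T) = taylor M t * ∏ v ∈ T.toFinset,
      (Q.sum fun N c => c * taylor N v) ^ T.count v / ((T.count v).factorial : K) := by
  simp only [taylor, fold_app, taylorStep, RTerm.dest_app]
  congr 1
  refine Finset.prod_congr rfl fun v _ => ?_
  congr 2
  exact Finsupp.sum_mapDomain_index (by simp) (by intros; ring)

end AlgTerm

/-- The vectors with support in the collection `F` of sets of simple terms. -/
def vectors (K : Type u) [Field K] (F : Set (Set RTerm)) : Set (RTerm → K) :=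
  {a | Function.support a ∈ F}

end

namespace RTerm

/-! ### Constructors and renaming -/

/-! The argument is a reducibility proof. Saturated spaces play the role of reducibility candidates:
they lie between the sets headed by a variable and `Nfv`, and they are stable under head expansion.
Three facts make the class work: `Nfv` is itself saturated (`isSaturated_nfvSpace`), and saturation
passes to arrows (`isSaturated_impl`) and to intersections (`isSaturated_interSat`). Part 1 is then
an induction on typing derivations (`Typed.msubstSet_shape_mem`).

The combinatorial core is `nfv_expansion`. If `t` lies below a term headed by a redex, then either
`t` can be reached by firing that redex first, or only subterms were reduced and `t` still shows the
redex (`below_spine_redex`). In the first case finiteness comes from the substituted family, because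
a term has finitely many antecedents under firing (`finite_setOf_fill_betaEnv`). In the second it
comes from the body and the arguments separately. The dichotomy rests on performing internal steps
after the firing (`Below.exists_fill`).

Only the occurrence of terms in reducts matters, not their coefficients. Substitution is therefore
studied through the relation `Fill`, whose labels in a commutative monoid record which resources
were spent. Comparing labels (`Fill.sim`, `Fill.sim_split`) and composing fillings (`fill_compEnv`)
yield the substitution lemmas.

For an abstraction, expansion requires the body to be in `Nfv`. This is seen by naming the bound
variable with a variable absent from the substituted sets, which exists because members of `Nfv`
have finitely many free variables (`bodySubstSet_mem_nfv`).

For part 2, interpret every type variable by `Nfv` and substitute each variable for itself. The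
shape of `M`, hence the support of its Taylor expansion, is then in `Nfv`. Finiteness of its
intersection with each cone `up t` says that `t` is produced by finitely many terms of the support.
-/

@[simp] theorem var_inj {x y : ℕ} : var x = var y ↔ x = y :=
  ⟨fun h => by simpa using congrArg dest h, fun h => h ▸ rfl⟩

@[simp] theorem lam_inj {s t : RTerm} : lam s = lam t ↔ s = t :=
  ⟨fun h => by simpa using congrArg dest h, fun h => h ▸ rfl⟩

@[simp] theorem app_inj {s t : RTerm} {S T : RPoly} : app s S = app t T ↔ s = t ∧ S = T :=
  ⟨fun h => by simpa using congrArg dest h, fun h => h.1 ▸ h.2 ▸ rfl⟩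

@[simp] theorem var_ne_lam {x : ℕ} {s : RTerm} : var x ≠ lam s :=
  fun h => by simpa using congrArg dest h

@[simp] theorem var_ne_app {x : ℕ} {s : RTerm} {S : RPoly} : var x ≠ app s S :=
  fun h => by simpa using congrArg dest h

@[simp] theorem lam_ne_app {s t : RTerm} {S : RPoly} : lam s ≠ app t S :=
  fun h => by simpa using congrArg dest h

@[simp] theorem app_ne_lam {s t : RTerm} {S : RPoly} : app t S ≠ lam s := lam_ne_app.symm

theorem liftRen_comp (f g : ℕ → ℕ) (x : ℕ) :
    liftRen g (liftRen f x) = liftRen (fun k => g (f k)) x := by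
  cases x <;> rfl

theorem rename_rename (s : RTerm) : ∀ f g : ℕ → ℕ,
    rename (rename s f) g = rename s fun k => g (f k) := by
  induction s using ind with
  | hvar x => simp
  | hlam s ih => intro f g; simp only [rename_lam, ih, liftRen_comp]
  | happ s S ihs ihS =>
    intro f g
    simp only [rename_app, ihs, Multiset.map_map, Function.comp_def, app_inj, true_and]
    exact Multiset.map_congr rfl fun t ht => ihS t ht f g

theorem rename_eq_self (s : RTerm) : ∀ f : ℕ → ℕ, (∀ k ∈ fv s, f k = k) → rename s f = s := by
  induction s using ind with
  | hvar x => intro f h; simpa using h x (by simp)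
  | hlam s ih =>
    intro f h
    rw [rename_lam, ih]
    intro k hk
    cases k with
    | zero => rfl
    | succ k => exact congrArg Nat.succ (h k (by simpa using hk))
  | happ s S ihs ihS =>
    intro f h
    rw [rename_app, ihs f fun k hk => h k (by simp [hk])]
    congr 1
    conv_rhs => rw [← Multiset.map_id S]
    exact Multiset.map_congr rfl fun t ht => ihS t ht f fun k hk => h k (by simp; exact .inr ⟨t, ht, hk⟩)

theorem exists_of_mem_fv_rename (s : RTerm) : ∀ (f : ℕ → ℕ) {y : ℕ}, y ∈ fv (rename s f) →
    ∃ x ∈ fv s, f x = y := by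
  induction s using ind with
  | hvar x => intro f y h; simpa [eq_comm] using h
  | hlam s ih =>
    intro f y h
    rw [rename_lam, fv_lam] at h
    obtain ⟨x, hx, hxy⟩ := ih _ h
    cases x with
    | zero => exact absurd hxy (by simp [liftRen])
    | succ x => exact ⟨x, by simpa using hx, by simpa [liftRen] using hxy⟩
  | happ s S ihs ihS =>
    intro f y h
    rw [rename_app, fv_app] at h
    rcases h with h | ⟨t, ht, h⟩
    · obtain ⟨x, hx, hxy⟩ := ihs _ h
      exact ⟨x, by simp [hx], hxy⟩
    · obtain ⟨t, htS, rfl⟩ := Multiset.mem_map.1 ht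
      obtain ⟨x, hx, hxy⟩ := ihS t htS _ h
      exact ⟨x, by simp; exact .inr ⟨t, htS, hx⟩, hxy⟩

theorem finite_fv (s : RTerm) : (fv s).Finite := by
  induction s using ind with
  | hvar x => simp
  | hlam s ih =>
    rw [fv_lam]
    exact ih.preimage (fun a _ b _ h => Nat.succ_injective h)
  | happ s S ihs ihS =>
    have : fv (app s S) = fv s ∪ ⋃ t ∈ S.toFinset, fv t := by ext k; simp
    rw [this]
    exact ihs.union (S.toFinset.finite_toSet.biUnion fun t ht => ihS t (by simpa using ht))

/-! ### Filling the free occurrences of variables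

`Fill s c a t` says that `t` is obtained from `s` by replacing each free occurrence of each
variable `x` by some `v` with `c x b v`, and that `a` is the sum of the labels `b` of all these
replacements.  `FillPoly` is the same for poly-terms. -/

section Fill

variable {A B : Type} [AddCommMonoid A] [AddCommMonoid B]

/-- Extend an environment under a binder. -/
def liftEnv (c : ℕ → A → RTerm → Prop) : ℕ → A → RTerm → Prop
  | 0, a, v => a = 0 ∧ v = var 0
  | k + 1, a, v => ∃ w, c k a w ∧ v = rename w Nat.succ

/-- `t` is obtained by filling the free occurrences of variables of `s`. -/
noncomputable def Fill (s : RTerm) (c : ℕ → A → RTerm → Prop) : A → RTerm → Prop :=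
  fold (α := (ℕ → A → RTerm → Prop) → A → RTerm → Prop)
    (fun
      | .var x => fun c => c x
      | .lam r => fun c a v => ∃ w, r (liftEnv c) a w ∧ v = lam w
      | .app r R => fun c a v => ∃ (b : A) (w : RTerm) (P : Multiset (A × RTerm)), r c b w ∧
          Multiset.Rel (fun q p => q c p.1 p.2) R P ∧ a = b + (P.map Prod.fst).sum ∧
          v = app w (P.map Prod.snd)) s c

/-- Elementwise extension of `Fill` to poly-terms. -/
def FillPoly (S : RPoly) (c : ℕ → A → RTerm → Prop) (a : A) (T : RPoly) : Prop :=
  ∃ P : Multiset (A × RTerm), Multiset.Rel (fun s p => Fill s c p.1 p.2) S P ∧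
    a = (P.map Prod.fst).sum ∧ T = P.map Prod.snd

@[simp] theorem fill_var (x : ℕ) (c : ℕ → A → RTerm → Prop) (a : A) (v : RTerm) :
    Fill (var x) c a v ↔ c x a v := by
  simp only [Fill, fold_var]

theorem fill_lam (s : RTerm) (c : ℕ → A → RTerm → Prop) (a : A) (v : RTerm) :
    Fill (lam s) c a v ↔ ∃ w, Fill s (liftEnv c) a w ∧ v = lam w := by
  simp only [Fill, fold_lam]

theorem fill_app (s : RTerm) (S : RPoly) (c : ℕ → A → RTerm → Prop) (a : A) (v : RTerm) :
    Fill (app s S) c a v ↔ ∃ b w d W, Fill s c b w ∧ FillPoly S c d W ∧ a = b + d ∧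
      v = app w W := by
  simp only [Fill, fold_app, FillPoly, Multiset.rel_map_left]
  constructor
  · rintro ⟨b, w, P, h1, h2, h3, h4⟩
    exact ⟨b, w, _, _, h1, ⟨P, h2, rfl, rfl⟩, h3, h4⟩
  · rintro ⟨b, w, d, W, h1, ⟨P, h2, rfl, rfl⟩, h3, h4⟩
    exact ⟨b, w, P, h1, h2, h3, h4⟩

@[simp] theorem fillPoly_zero (c : ℕ → A → RTerm → Prop) (a : A) (T : RPoly) :
    FillPoly 0 c a T ↔ a = 0 ∧ T = 0 := by
  simp [FillPoly, Multiset.rel_zero_left]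

theorem fillPoly_cons_left (s : RTerm) (S : RPoly) (c : ℕ → A → RTerm → Prop) (a : A)
    (T : RPoly) : FillPoly (s ::ₘ S) c a T ↔ ∃ b v d V, Fill s c b v ∧ FillPoly S c d V ∧
      a = b + d ∧ T = v ::ₘ V := by
  simp only [FillPoly, Multiset.rel_cons_left]
  constructor
  · rintro ⟨_, ⟨p, P, h1, h2, rfl⟩, rfl, rfl⟩
    exact ⟨_, _, _, _, h1, ⟨P, h2, rfl, rfl⟩, by simp, by simp⟩
  · rintro ⟨b, v, _, _, h1, ⟨P, h2, rfl, rfl⟩, rfl, rfl⟩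
    exact ⟨(b, v) ::ₘ P, ⟨_, P, h1, h2, rfl⟩, by simp, by simp⟩

/-- Reads a filling from its result; this is the direction needed to count antecedents. -/
theorem fillPoly_cons_right (S : RPoly) (c : ℕ → A → RTerm → Prop) (a : A) (v : RTerm)
    (V : RPoly) : FillPoly S c a (v ::ₘ V) ↔ ∃ b s d T, Fill s c b v ∧ FillPoly T c d V ∧
      a = b + d ∧ S = s ::ₘ T := by
  constructor
  · rintro ⟨P, h, rfl, h'⟩
    obtain ⟨p, hp, rfl, rfl⟩ := (Multiset.map_eq_cons _ _ _ _).2 h'.symm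
    rw [← Multiset.cons_erase hp, Multiset.rel_cons_right] at h
    obtain ⟨s, T, h1, h2, rfl⟩ := h
    refine ⟨_, s, _, T, h1, ⟨_, h2, rfl, rfl⟩, ?_, rfl⟩
    conv_lhs => rw [← Multiset.cons_erase hp]
    simp
  · rintro ⟨b, s, d, T, h1, h2, rfl, rfl⟩
    exact (fillPoly_cons_left _ _ _ _ _).2 ⟨b, v, d, V, h1, h2, rfl, rfl⟩

theorem FillPoly.eq_zero {S : RPoly} {c : ℕ → A → RTerm → Prop} {a : A}
    (h : FillPoly S c a 0) : S = 0 ∧ a = 0 := by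
  induction S using Multiset.induction_on with
  | empty => exact ⟨rfl, ((fillPoly_zero _ _ _).1 h).1⟩
  | cons s S _ =>
    obtain ⟨_, _, _, _, _, _, _, h⟩ := (fillPoly_cons_left _ _ _ _ _).1 h
    exact absurd h.symm (Multiset.cons_ne_zero)

theorem FillPoly.add {S T : RPoly} {c : ℕ → A → RTerm → Prop} {a b : A} {V W : RPoly}
    (h : FillPoly S c a V) (h' : FillPoly T c b W) : FillPoly (S + T) c (a + b) (V + W) := by
  obtain ⟨P, h1, rfl, rfl⟩ := h
  obtain ⟨Q, h2, rfl, rfl⟩ := h'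
  exact ⟨P + Q, h1.add h2, by simp, by simp⟩

theorem FillPoly.exists_of_mem {S : RPoly} {c : ℕ → A → RTerm → Prop} {a : A} {T : RPoly}
    (h : FillPoly S c a T) {t : RTerm} (ht : t ∈ T) :
    ∃ s ∈ S, ∃ b d, Fill s c b t ∧ a = b + d := by
  obtain ⟨T, rfl⟩ := Multiset.exists_cons_of_mem ht
  obtain ⟨b, s, d, S, h1, _, rfl, rfl⟩ := (fillPoly_cons_right _ _ _ _ _).1 h
  exact ⟨s, by simp, b, d, h1, rfl⟩

/-- Simulation of fillings, for an additive relation on labels. -/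
theorem Fill.sim {Φ : A → B → Prop} (h0 : Φ 0 0)
    (hadd : ∀ {a b a' b'}, Φ a b → Φ a' b' → Φ (a + a') (b + b')) {s : RTerm} :
    ∀ {c : ℕ → A → RTerm → Prop} {d : ℕ → B → RTerm → Prop} {a : A} {v : RTerm},
      (∀ x ∈ fv s, ∀ a v, c x a v → ∃ b, Φ a b ∧ d x b v) →
      Fill s c a v → ∃ b, Φ a b ∧ Fill s d b v := by
  induction s using ind with
  | hvar x =>
    intro c d a v hcd hf
    simpa using hcd x (by simp) a v (by simpa using hf)
  | hlam s ih =>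
    intro c d a v hcd hf
    obtain ⟨w, h, rfl⟩ := (fill_lam _ _ _ _).1 hf
    obtain ⟨b, hb, h⟩ := ih (d := liftEnv d) (by
      rintro (_ | x) hx a v h
      · obtain ⟨rfl, rfl⟩ := h
        exact ⟨0, h0, rfl, rfl⟩
      · obtain ⟨w, h, rfl⟩ := h
        obtain ⟨b, hb, h⟩ := hcd x (by simpa using hx) a w h
        exact ⟨b, hb, w, h, rfl⟩) h
    exact ⟨b, hb, (fill_lam _ _ _ _).2 ⟨w, h, rfl⟩⟩
  | happ s S ihs ihS =>
    intro c d a v hcd hf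
    obtain ⟨b, w, b', W, h, hP, rfl, rfl⟩ := (fill_app _ _ _ _ _).1 hf
    obtain ⟨e, he, h⟩ := ihs (fun x hx => hcd x (by simp [hx])) h
    clear hf
    -- The arguments are treated one at a time, adding the label relations.
    have hP' : ∃ e', Φ b' e' ∧ FillPoly S d e' W := by
      have hcd : ∀ t ∈ S, ∀ x ∈ fv t, ∀ a v, c x a v → ∃ b, Φ a b ∧ d x b v :=
        fun t ht x hx => hcd x (by simp; exact .inr ⟨t, ht, hx⟩)
      clear h he ihs
      clear * - hcd hP ihS hadd h0
      induction S using Multiset.induction_on generalizing b' W with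
      | empty =>
        obtain ⟨rfl, rfl⟩ := (fillPoly_zero _ _ _).1 hP
        exact ⟨0, h0, by simp⟩
      | cons t S ih =>
        obtain ⟨p, q, p', q', h1, h2, rfl, rfl⟩ := (fillPoly_cons_left _ _ _ _ _).1 hP
        obtain ⟨e, he, h1⟩ := ihS t (by simp) (hcd t (by simp)) h1
        obtain ⟨e', he', h2⟩ := ih (fun t ht => ihS t (by simp [ht])) _ _ h2
          (fun t ht => hcd t (by simp [ht]))
        exact ⟨_, hadd he he', (fillPoly_cons_left _ _ _ _ _).2 ⟨_, _, _, _, h1, h2, rfl, rfl⟩⟩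
    obtain ⟨e', he', h'⟩ := hP'
    exact ⟨_, hadd he he', (fill_app _ _ _ _ _).2 ⟨_, _, _, _, h, h', rfl, rfl⟩⟩

/-- Simulation of fillings, for a relation on labels compatible with the splitting of sums on its
left, and a congruence on terms. -/
theorem Fill.sim_split {Ψ : A → B → Prop} {Θ : RTerm → RTerm → Prop}
    (h0 : ∀ {b}, Ψ 0 b → b = 0)
    (hadd : ∀ {a a' b}, Ψ (a + a') b → ∃ e e', Ψ a e ∧ Ψ a' e' ∧ b = e + e')
    (hrefl : Θ (var 0) (var 0)) (hlam : ∀ {s t}, Θ s t → Θ (lam s) (lam t))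
    (happ : ∀ {s t S T}, Θ s t → Multiset.Rel Θ S T → Θ (app s S) (app t T))
    (hren : ∀ {s t}, Θ s t → Θ (rename s Nat.succ) (rename t Nat.succ)) {s : RTerm} :
    ∀ {c : ℕ → A → RTerm → Prop} {d : ℕ → B → RTerm → Prop} {a : A} {b : B} {v : RTerm},
      (∀ x a b v, c x a v → Ψ a b → ∃ v', d x b v' ∧ Θ v v') →
      Fill s c a v → Ψ a b → ∃ v', Fill s d b v' ∧ Θ v v' := by
  induction s using ind with
  | hvar x =>
    intro c d a b v hcd hf hab
    simpa using hcd x a b v (by simpa using hf) hab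
  | hlam s ih =>
    intro c d a b v hcd hf hab
    obtain ⟨w, h, rfl⟩ := (fill_lam _ _ _ _).1 hf
    obtain ⟨w', h, hw⟩ := ih (d := liftEnv d) (by
      rintro (_ | x) a b v h hab
      · obtain ⟨rfl, rfl⟩ := h
        exact ⟨var 0, ⟨h0 hab, rfl⟩, hrefl⟩
      · obtain ⟨w, h, rfl⟩ := h
        obtain ⟨w', h, hw⟩ := hcd x a b w h hab
        exact ⟨_, ⟨w', h, rfl⟩, hren hw⟩) h hab
    exact ⟨_, (fill_lam _ _ _ _).2 ⟨w', h, rfl⟩, hlam hw⟩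
  | happ s S ihs ihS =>
    intro c d a b v hcd hf hab
    obtain ⟨a, w, a', W, h, hP, rfl, rfl⟩ := (fill_app _ _ _ _ _).1 hf
    obtain ⟨b, b', hb, hb', rfl⟩ := hadd hab
    obtain ⟨w', h, hw⟩ := ihs hcd h hb
    have hP' : ∃ W', FillPoly S d b' W' ∧ Multiset.Rel Θ W W' := by
      clear hf h hb hab hw ihs
      induction S using Multiset.induction_on generalizing a' b' W with
      | empty =>
        obtain ⟨rfl, rfl⟩ := (fillPoly_zero _ _ _).1 hP
        exact ⟨0, by simp [h0 hb'], .zero⟩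
      | cons t S ih =>
        obtain ⟨p, q, p', q', h1, h2, rfl, rfl⟩ := (fillPoly_cons_left _ _ _ _ _).1 hP
        obtain ⟨e, e', he, he', rfl⟩ := hadd hb'
        obtain ⟨z, h1, hz⟩ := ihS t (by simp) hcd h1 he
        obtain ⟨Z, h2, hZ⟩ := ih (fun t ht => ihS t (by simp [ht])) _ _ h2 _ he'
        exact ⟨_, (fillPoly_cons_left _ _ _ _ _).2 ⟨_, _, _, _, h1, h2, rfl, rfl⟩, .cons hz hZ⟩
    obtain ⟨W', h', hW⟩ := hP'
    exact ⟨_, (fill_app _ _ _ _ _).2 ⟨_, _, _, _, h, h', rfl, rfl⟩, happ hw hW⟩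

end Fill

end RTerm

/-! ### Free variables, renaming, composition and antecedents of fillings. -/

namespace RTerm

section Fill

variable {A B : Type} [AddCommMonoid A] [AddCommMonoid B]

/-- Every free variable of the result sits inside some inserted value. The label of that value is a
summand of the total, which allows the value to be located among the substituted resources. -/
theorem Fill.exists_of_mem_fv {s : RTerm} :
    ∀ {c : ℕ → A → RTerm → Prop} {a : A} {v : RTerm}, Fill s c a v → ∀ {y : ℕ}, y ∈ fv v →
      ∃ x ∈ fv s, ∃ b d w, a = b + d ∧ c x b w ∧ y ∈ fv w := by
  induction s using ind with
  | hvar x =>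
    intro c a v h y hy
    exact ⟨x, by simp, a, 0, v, by simp, by simpa using h, hy⟩
  | hlam s ih =>
    intro c a v hf y hy
    obtain ⟨w, h, rfl⟩ := (fill_lam _ _ _ _).1 hf
    obtain ⟨x, hx, b, d, z, rfl, hc, hz⟩ := ih h (y := y + 1) (by simpa using hy)
    cases x with
    | zero =>
      obtain ⟨rfl, rfl⟩ := hc
      simp at hz
    | succ x =>
      obtain ⟨z, hc, rfl⟩ := hc
      obtain ⟨y', hy', h'⟩ := exists_of_mem_fv_rename _ _ hz
      obtain rfl := Nat.succ_injective h'
      exact ⟨x, by simpa using hx, b, d, z, rfl, hc, hy'⟩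
  | happ s S ihs ihS =>
    intro c a v hf y hy
    obtain ⟨b, w, d, W, h, hP, rfl, rfl⟩ := (fill_app _ _ _ _ _).1 hf
    rw [fv_app] at hy
    rcases hy with hy | ⟨t, ht, hy⟩
    · obtain ⟨x, hx, b, e, z, rfl, hc, hz⟩ := ihs h hy
      exact ⟨x, by simp [hx], b, e + d, z, by rw [add_assoc], hc, hz⟩
    · obtain ⟨u, hu, d, e, h', rfl⟩ := hP.exists_of_mem ht
      obtain ⟨x, hx, d, e', z, rfl, hc, hz⟩ := ihS u hu h' hy
      exact ⟨x, by simp; exact .inr ⟨u, hu, hx⟩, d, b + (e' + e), z, by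
        rw [add_assoc, add_left_comm], hc, hz⟩

theorem FillPoly.congr {S T : RPoly} {f : RTerm → RTerm} {c : ℕ → A → RTerm → Prop}
    {d : ℕ → A → RTerm → Prop} (hT : T = S.map f)
    (h : ∀ s ∈ S, ∀ a v, Fill (f s) c a v ↔ Fill s d a v) (a : A) (V : RPoly) :
    FillPoly T c a V ↔ FillPoly S d a V := by
  subst hT
  simp only [FillPoly, Multiset.rel_map_left]
  constructor <;> rintro ⟨P, h1, h2⟩
  · exact ⟨P, h1.mono fun s hs p _ h' => (h s hs _ _).1 h', h2⟩
  · exact ⟨P, h1.mono fun s hs p _ h' => (h s hs _ _).2 h', h2⟩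

theorem fill_rename (s : RTerm) : ∀ (f : ℕ → ℕ) (c : ℕ → A → RTerm → Prop) (a : A) (v : RTerm),
    Fill (rename s f) c a v ↔ Fill s (fun x => c (f x)) a v := by
  induction s using ind with
  | hvar x => simp
  | hlam s ih =>
    intro f c a v
    have : (fun x => liftEnv c (liftRen f x)) = liftEnv fun x => c (f x) := by
      funext x; cases x <;> rfl
    simp only [rename_lam, fill_lam, ih, this]
  | happ s S ihs ihS =>
    intro f c a v
    have := FillPoly.congr (c := c) rfl fun s hs => ihS s hs f c
    simp only [rename_app, fill_app, ihs, this]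

/-- Composition of environments. -/
def compEnv (c : ℕ → A → RTerm → Prop) (d : ℕ → B → RTerm → Prop) (x : ℕ) (p : A × B)
    (w : RTerm) : Prop :=
  ∃ v, c x p.1 v ∧ Fill v d p.2 w

/-- Renaming of the values of an environment. -/
def renEnv (c : ℕ → A → RTerm → Prop) (f : ℕ → ℕ) (x : ℕ) (a : A) (w : RTerm) : Prop :=
  ∃ v, c x a v ∧ w = rename v f

theorem liftEnv_renEnv (c : ℕ → A → RTerm → Prop) (f : ℕ → ℕ) :
    liftEnv (renEnv c f) = renEnv (liftEnv c) (liftRen f) := by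
  funext x a w
  cases x with
  | zero =>
    refine propext ⟨?_, ?_⟩
    · rintro ⟨rfl, rfl⟩
      exact ⟨var 0, ⟨rfl, rfl⟩, by simp [liftRen]⟩
    · rintro ⟨_, ⟨rfl, rfl⟩, rfl⟩
      exact ⟨rfl, by simp [liftRen]⟩
  | succ x =>
    refine propext ⟨?_, ?_⟩
    · rintro ⟨_, ⟨v, h, rfl⟩, rfl⟩
      exact ⟨_, ⟨v, h, rfl⟩, by simp [rename_rename, liftRen]⟩
    · rintro ⟨_, ⟨v, h, rfl⟩, rfl⟩
      exact ⟨_, ⟨v, h, rfl⟩, by simp [rename_rename, liftRen]⟩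

theorem fill_renEnv (s : RTerm) : ∀ (f : ℕ → ℕ) (c : ℕ → A → RTerm → Prop) (a : A) (w : RTerm),
    Fill s (renEnv c f) a w ↔ ∃ v, Fill s c a v ∧ w = rename v f := by
  induction s using ind with
  | hvar x => simp [renEnv]
  | hlam s ih =>
    intro f c a v
    simp only [fill_lam, liftEnv_renEnv, ih]
    constructor
    · rintro ⟨_, ⟨w, h, rfl⟩, rfl⟩
      exact ⟨_, ⟨w, h, rfl⟩, by simp⟩
    · rintro ⟨_, ⟨w, h, rfl⟩, rfl⟩
      exact ⟨_, ⟨w, h, rfl⟩, by simp⟩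
  | happ s S ihs ihS =>
    intro f c a v
    have hS : ∀ a W, FillPoly S (renEnv c f) a W ↔
        ∃ V, FillPoly S c a V ∧ W = V.map fun t => rename t f := by
      clear ihs
      induction S using Multiset.induction_on with
      | empty => simp
      | cons s S ih =>
        intro a W
        simp only [fillPoly_cons_left, ihS s (by simp), ih fun t ht => ihS t (by simp [ht])]
        constructor
        · rintro ⟨b, _, d, _, ⟨w, h1, rfl⟩, ⟨W, h2, rfl⟩, rfl, rfl⟩
          exact ⟨_, ⟨b, w, d, W, h1, h2, rfl, rfl⟩, by simp⟩
        · rintro ⟨_, ⟨b, w, d, W, h1, h2, rfl, rfl⟩, rfl⟩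
          exact ⟨b, _, d, _, ⟨w, h1, rfl⟩, ⟨W, h2, rfl⟩, rfl, by simp⟩
    simp only [fill_app, ihs, hS]
    constructor
    · rintro ⟨b, _, d, _, ⟨w, h1, rfl⟩, ⟨W, h2, rfl⟩, rfl, rfl⟩
      exact ⟨_, ⟨b, w, d, W, h1, h2, rfl, rfl⟩, by simp⟩
    · rintro ⟨_, ⟨b, w, d, W, h1, h2, rfl, rfl⟩, rfl⟩
      exact ⟨b, _, d, _, ⟨w, h1, rfl⟩, ⟨W, h2, rfl⟩, rfl, by simp⟩

theorem fill_rename_succ_liftEnv (s : RTerm) (c : ℕ → A → RTerm → Prop) (a : A) (v : RTerm) :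
    Fill (rename s Nat.succ) (liftEnv c) a v ↔ ∃ w, Fill s c a w ∧ v = rename w Nat.succ := by
  rw [fill_rename, ← fill_renEnv]
  rfl

theorem liftEnv_compEnv (c : ℕ → A → RTerm → Prop) (d : ℕ → B → RTerm → Prop) :
    liftEnv (compEnv c d) = compEnv (liftEnv c) (liftEnv d) := by
  funext x p w
  cases x with
  | zero =>
    refine propext ⟨?_, ?_⟩
    · rintro ⟨rfl, rfl⟩
      exact ⟨var 0, ⟨rfl, rfl⟩, (fill_var _ _ _ _).2 ⟨rfl, rfl⟩⟩
    · rintro ⟨_, ⟨h, rfl⟩, h'⟩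
      have hw := (fill_var _ _ _ _).1 h'
      exact ⟨Prod.ext h hw.1, hw.2⟩
  | succ x =>
    refine propext ⟨?_, ?_⟩
    · rintro ⟨w, ⟨v, h, h'⟩, rfl⟩
      exact ⟨_, ⟨v, h, rfl⟩, (fill_rename_succ_liftEnv _ _ _ _).2 ⟨w, h', rfl⟩⟩
    · rintro ⟨_, ⟨v, h, rfl⟩, hw⟩
      obtain ⟨w, h', rfl⟩ := (fill_rename_succ_liftEnv _ _ _ _).1 hw
      exact ⟨w, ⟨v, h, h'⟩, rfl⟩

/-- The substitution lemma. Labels of the two stages are kept apart in `A × B`, so successive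
fillings can be merged occurrence by occurrence. Commutation of substitutions then reduces to
comparing composite environments on variables with `Fill.sim`. -/
theorem fill_compEnv (s : RTerm) : ∀ (c : ℕ → A → RTerm → Prop) (d : ℕ → B → RTerm → Prop)
    (p : A × B) (w : RTerm),
    Fill s (compEnv c d) p w ↔ ∃ v, Fill s c p.1 v ∧ Fill v d p.2 w := by
  induction s using ind with
  | hvar x => simp [compEnv]
  | hlam s ih =>
    intro c d p w
    simp only [fill_lam, liftEnv_compEnv, ih]
    constructor
    · rintro ⟨w, ⟨v, h1, h2⟩, rfl⟩
      exact ⟨_, ⟨v, h1, rfl⟩, (fill_lam _ _ _ _).2 ⟨w, h2, rfl⟩⟩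
    · rintro ⟨_, ⟨v, h1, rfl⟩, hw⟩
      obtain ⟨w, h2, rfl⟩ := (fill_lam _ _ _ _).1 hw
      exact ⟨w, ⟨v, h1, h2⟩, rfl⟩
  | happ s S ihs ihS =>
    intro c d p w
    have hS : ∀ p W, FillPoly S (compEnv c d) p W ↔
        ∃ V, FillPoly S c p.1 V ∧ FillPoly V d p.2 W := by
      clear ihs
      induction S using Multiset.induction_on with
      | empty => simp [Prod.ext_iff, and_assoc]
      | cons s S ih =>
        intro p W
        simp only [fillPoly_cons_left, ihS s (by simp), ih fun t ht => ihS t (by simp [ht])]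
        constructor
        · rintro ⟨p, w, q, W, ⟨v, h1, h2⟩, ⟨V, h3, h4⟩, rfl, rfl⟩
          exact ⟨_, ⟨_, v, _, V, h1, h3, rfl, rfl⟩,
            (fillPoly_cons_left _ _ _ _ _).2 ⟨_, _, _, _, h2, h4, rfl, rfl⟩⟩
        · rintro ⟨_, ⟨a, v, b, V, h1, h3, hp, rfl⟩, h⟩
          obtain ⟨a', w, b', W, h2, h4, hp', rfl⟩ := (fillPoly_cons_left _ _ _ _ _).1 h
          exact ⟨(a, a'), w, (b, b'), W, ⟨v, h1, h2⟩, ⟨V, h3, h4⟩, Prod.ext hp hp', rfl⟩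
    simp only [fill_app, ihs, hS]
    constructor
    · rintro ⟨p, w, q, W, ⟨v, h1, h2⟩, ⟨V, h3, h4⟩, rfl, rfl⟩
      exact ⟨_, ⟨_, v, _, V, h1, h3, rfl, rfl⟩,
        (fill_app _ _ _ _ _).2 ⟨_, _, _, _, h2, h4, rfl, rfl⟩⟩
    · rintro ⟨_, ⟨a, v, b, V, h1, h3, hp, rfl⟩, h⟩
      obtain ⟨a', w, b', W, h2, h4, hp', rfl⟩ := (fill_app _ _ _ _ _).1 h
      exact ⟨(a, a'), w, (b, b'), W, ⟨v, h1, h2⟩, ⟨V, h3, h4⟩, Prod.ext hp hp', rfl⟩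

/-- The environment which leaves terms unchanged. -/
def idEnv (x : ℕ) (a : A) (v : RTerm) : Prop := a = 0 ∧ v = var x

theorem liftEnv_idEnv : liftEnv (idEnv : ℕ → A → RTerm → Prop) = idEnv := by
  funext x a v
  cases x with
  | zero => rfl
  | succ x =>
    refine propext ⟨?_, ?_⟩
    · rintro ⟨_, ⟨rfl, rfl⟩, rfl⟩
      exact ⟨rfl, by simp⟩
    · rintro ⟨rfl, rfl⟩
      exact ⟨_, ⟨rfl, rfl⟩, by simp⟩

theorem fill_idEnv (s : RTerm) : ∀ (a : A) (v : RTerm), Fill s idEnv a v ↔ a = 0 ∧ v = s := by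
  induction s using ind with
  | hvar x => simp [idEnv]
  | hlam s ih =>
    intro a v
    rw [fill_lam, liftEnv_idEnv]
    simp [ih, and_assoc]
  | happ s S ihs ihS =>
    intro a v
    have hS : ∀ (a : A) V, FillPoly S idEnv a V ↔ a = 0 ∧ V = S := by
      clear ihs
      induction S using Multiset.induction_on with
      | empty => simp
      | cons s S ih =>
        intro p W
        simp only [fillPoly_cons_left, ihS s (by simp), ih fun t ht => ihS t (by simp [ht])]
        constructor
        · rintro ⟨_, _, _, _, ⟨rfl, rfl⟩, ⟨rfl, rfl⟩, rfl, rfl⟩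
          simp
        · rintro ⟨rfl, rfl⟩
          exact ⟨_, _, _, _, ⟨rfl, rfl⟩, ⟨rfl, rfl⟩, by simp, rfl⟩
    simp only [fill_app, ihs, hS]
    constructor
    · rintro ⟨_, _, _, _, ⟨rfl, rfl⟩, ⟨rfl, rfl⟩, rfl, rfl⟩
      simp
    · rintro ⟨rfl, rfl⟩
      exact ⟨_, _, _, _, ⟨rfl, rfl⟩, ⟨rfl, rfl⟩, by simp, rfl⟩

/-- Only finitely many fillings have a given result, if this is so for variables. -/
theorem finite_setOf_fill (v : RTerm) : ∀ c : ℕ → A → RTerm → Prop,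
    (∀ w, {p : ℕ × A | c p.1 p.2 w}.Finite) → {p : RTerm × A | Fill p.1 c p.2 v}.Finite := by
  -- Variable sources are controlled by the hypothesis on `c`. Any other source has the same
  -- outermost constructor as the result, so the induction applies to its components.
  have key : ∀ (v : RTerm) (c : ℕ → A → RTerm → Prop), (∀ w, {p : ℕ × A | c p.1 p.2 w}.Finite) →
      {p : RTerm × A | (∀ x, p.1 ≠ var x) ∧ Fill p.1 c p.2 v}.Finite →
      {p : RTerm × A | Fill p.1 c p.2 v}.Finite := by
    intro v c hc h
    refine (h.union ((hc v).image fun p => (var p.1, p.2))).subset ?_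
    rintro ⟨s, a⟩ hs
    by_cases hx : ∃ x, s = var x
    · obtain ⟨x, rfl⟩ := hx
      exact .inr ⟨(x, a), by simpa using hs, rfl⟩
    · exact .inl ⟨fun x hx' => hx ⟨x, hx'⟩, hs⟩
  induction v using ind with
  | hvar x =>
    intro c hc
    refine key _ c hc (Set.Finite.subset Set.finite_empty ?_)
    rintro ⟨s, a⟩ ⟨h1, h2⟩
    induction s using ind with
    | hvar x => exact h1 x rfl
    | hlam s => obtain ⟨w, _, h⟩ := (fill_lam _ _ _ _).1 h2; simp at h
    | happ s S => obtain ⟨_, _, _, _, _, _, _, h⟩ := (fill_app _ _ _ _ _).1 h2; simp at h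
  | hlam v ih =>
    intro c hc
    refine key _ c hc (((ih (liftEnv c) ?_).image fun p => (lam p.1, p.2)).subset ?_)
    · intro w
      by_cases hw : ∃ w', w = rename w' Nat.succ
      · obtain ⟨w', rfl⟩ := hw
        refine (((hc w').image fun p => (p.1 + 1, p.2)).union (Set.finite_singleton (0, 0))).subset ?_
        rintro ⟨_ | x, a⟩ h
        · exact .inr (Prod.ext rfl h.1)
        · obtain ⟨z, h, hz⟩ := h
          -- `Nat.pred` undoes the shift, so shifting is injective on terms.
          have hz' := congrArg (fun s => rename s Nat.pred) hz
          simp only [rename_rename, Nat.pred_succ] at hz'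
          rw [rename_eq_self _ _ fun _ _ => rfl, rename_eq_self _ _ fun _ _ => rfl] at hz'
          subst hz'
          exact .inl ⟨(x, a), h, rfl⟩
      · refine (Set.finite_singleton (0, 0)).subset ?_
        rintro ⟨_ | x, a⟩ h
        · exact Prod.ext rfl h.1
        · obtain ⟨z, h, hz⟩ := h
          exact absurd ⟨z, hz⟩ hw
    · rintro ⟨s, a⟩ ⟨h1, h2⟩
      induction s using ind with
      | hvar x => exact absurd rfl (h1 x)
      | hlam s =>
        obtain ⟨w, h, h'⟩ := (fill_lam _ _ _ _).1 h2
        rw [lam_inj] at h'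
        subst h'
        exact ⟨(s, a), h, rfl⟩
      | happ s S => obtain ⟨_, _, _, _, _, _, _, h⟩ := (fill_app _ _ _ _ _).1 h2; simp at h
  | happ v V ihv ihV =>
    intro c hc
    have hV : {p : RPoly × A | FillPoly p.1 c p.2 V}.Finite := by
      clear ihv
      induction V using Multiset.induction_on with
      | empty =>
        refine (Set.finite_singleton (0, 0)).subset ?_
        rintro ⟨S, a⟩ h
        obtain ⟨rfl, rfl⟩ := FillPoly.eq_zero h
        rfl
      | cons v V ih =>
        refine (((ihV v (by simp) c hc).prod (ih fun t ht => ihV t (by simp [ht]))).image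
          fun p => (p.1.1 ::ₘ p.2.1, p.1.2 + p.2.2)).subset ?_
        rintro ⟨S, a⟩ h
        obtain ⟨b, s, d, T, h1, h2, rfl, rfl⟩ := (fillPoly_cons_right _ _ _ _ _).1 h
        exact ⟨((s, b), (T, d)), ⟨h1, h2⟩, rfl⟩
    refine key _ c hc ((((ihv c hc).prod hV).image
      fun p => (app p.1.1 p.2.1, p.1.2 + p.2.2)).subset ?_)
    rintro ⟨s, a⟩ ⟨h1, h2⟩
    induction s using ind with
    | hvar x => exact absurd rfl (h1 x)
    | hlam s => obtain ⟨w, _, h⟩ := (fill_lam _ _ _ _).1 h2; simp at h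
    | happ s S =>
      obtain ⟨b, w, d, W, h, h', rfl, h''⟩ := (fill_app _ _ _ _ _).1 h2
      obtain ⟨rfl, rfl⟩ := app_inj.1 h''
      exact ⟨((s, b), (S, d)), ⟨h, h'⟩, rfl⟩

/-! ### Differential substitution as a filling -/

theorem mem_plug {L : Type} (s : RTerm) : ∀ (c : ℕ → Multiset (RTerm × Multiset L))
    (a : Multiset L) (v : RTerm),
    (v, a) ∈ plug s c ↔ Fill s (fun x a v => (v, a) ∈ c x) a v := by
  induction s using ind with
  | hvar x => simp
  | hlam s ih =>
    intro c a v
    have : (liftEnv fun x a v => (v, a) ∈ c x) = fun x a v => (v, a) ∈ liftCand c x := by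
      funext x a v
      cases x with
      | zero => simp [liftEnv, liftCand, and_comm]
      | succ x =>
        simp only [liftEnv, liftCand, Multiset.mem_map, Prod.exists, Prod.mk.injEq, eq_iff_iff]
        constructor
        · rintro ⟨w, h, rfl⟩
          exact ⟨w, a, h, rfl, rfl⟩
        · rintro ⟨w, _, h, rfl, rfl⟩
          exact ⟨w, h, rfl⟩
    simp only [plug_lam, fill_lam, this, ← ih, Multiset.mem_map, Prod.exists, Prod.mk.injEq]
    constructor
    · rintro ⟨w, _, h, rfl, rfl⟩
      exact ⟨w, h, rfl⟩
    · rintro ⟨w, h, rfl⟩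
      exact ⟨w, a, h, rfl, rfl⟩
  | happ s S ihs ihS =>
    intro c a v
    simp only [plug_app, fill_app, ← ihs, FillPoly, Multiset.mem_map, Prod.exists, Prod.mk.injEq,
      Multiset.mem_product, Multiset.mem_sections, Multiset.rel_map_left]
    constructor
    · rintro ⟨w, b, P, ⟨h1, h2⟩, rfl, rfl⟩
      refine ⟨b, w, _, _, h1, ⟨P.map Prod.swap, ?_, rfl, rfl⟩, ?_, ?_⟩
      · rw [Multiset.rel_map_right]
        exact h2.mono fun s hs p _ h => (ihS s hs _ _ _).1 h
      · simp [Multiset.map_map]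
      · simp [Multiset.map_map]
    · rintro ⟨b, w, _, _, h1, ⟨P, h2, rfl, rfl⟩, rfl, rfl⟩
      refine ⟨w, b, P.map Prod.swap, ⟨h1, ?_⟩, ?_, ?_⟩
      · rw [Multiset.rel_map_right]
        exact h2.mono fun s hs p _ h => (ihS s hs _ _ _).2 h
      · simp [Multiset.map_map]
      · simp [Multiset.map_map]

/-- The environment of parallel differential substitution: the variable `x < n` takes any value,
recorded at index `x`, and the variable `n + k` becomes the variable `k`. -/
def subEnv (n : ℕ) (x : ℕ) (a : Fin n → RPoly) (v : RTerm) : Prop :=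
  if h : x < n then a = Pi.single ⟨x, h⟩ {v} else a = 0 ∧ v = var (x - n)

/-- Translates "every label is used exactly once" into "the total resource spent is `S`". -/
theorem sum_pi_single_map_univ {n : ℕ} (S : Fin n → RPoly) :
    ((Finset.univ : Finset (Label S)).val.map
      fun l => (Pi.single l.1 {l.2.1} : Fin n → RPoly)).sum = S := by
  have h : ∀ i, ∑ l : (S i).ToType, (Pi.single i {l.1} : Fin n → RPoly) = Pi.single i (S i) := by
    intro i
    have h1 : ∑ l : (S i).ToType, ({l.1} : RPoly) = S i := by
      have h2 : ((Finset.univ.val.map fun x : (S i).ToType => x.1).map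
          fun x => ({x} : RPoly)).sum = S i := by
        rw [Multiset.map_univ_coe, Multiset.sum_map_singleton]
      rw [Multiset.map_map] at h2
      exact h2
    conv_rhs => rw [← h1]
    exact (map_sum (AddMonoidHom.single (fun _ => RPoly) i) _ _).symm
  change ∑ l : Label S, (Pi.single l.1 {l.2.1} : Fin n → RPoly) = S
  rw [Fintype.sum_sigma]
  simp only [h]
  exact Finset.univ_sum_single S

theorem exists_eq_single_add {n : ℕ} {a : Fin n → RPoly} {i : Fin n} {t : RTerm}
    (h : t ∈ a i) : ∃ b : Fin n → RPoly, a = Pi.single i {t} + b := by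
  refine ⟨Function.update a i ((a i).erase t), ?_⟩
  funext j
  by_cases hj : j = i
  · subst hj
    simp [Multiset.cons_erase h]
  · simp [hj]

theorem eq_zero_of_sum_single_eq_zero {n : ℕ} {α : Type} {f : α → Fin n} {g : α → RTerm}
    {b : Multiset α} (h : (b.map fun l => (Pi.single (f l) {g l} : Fin n → RPoly)).sum = 0) :
    b = 0 := by
  induction b using Multiset.induction_on with
  | empty => rfl
  | cons l b _ =>
    have := congrFun h (f l)
    simp at this

/-- Labels are peeled off one at a time: the value of each belongs to one of the two summands. This
provides the splitting hypothesis of `Fill.sim_split`. -/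
theorem exists_split_of_sum_single_eq_add {n : ℕ} {α : Type} {f : α → Fin n} {g : α → RTerm}
    {b : Multiset α} : ∀ {a a' : Fin n → RPoly},
      a + a' = (b.map fun l => (Pi.single (f l) {g l} : Fin n → RPoly)).sum →
      ∃ e e', a = (e.map fun l => (Pi.single (f l) {g l} : Fin n → RPoly)).sum ∧
        a' = (e'.map fun l => (Pi.single (f l) {g l} : Fin n → RPoly)).sum ∧ b = e + e' := by
  induction b using Multiset.induction_on with
  | empty =>
    intro a a' h
    have h' : ∀ i, a i = 0 ∧ a' i = 0 := fun i => by simpa using congrFun h i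
    exact ⟨0, 0, funext fun i => (h' i).1, funext fun i => (h' i).2, rfl⟩
  | cons l b ih =>
    intro a a' h
    rw [Multiset.map_cons, Multiset.sum_cons] at h
    have hl : g l ∈ (a + a') (f l) := by rw [h]; simp
    rcases Multiset.mem_add.1 hl with hl | hl
    · obtain ⟨a, rfl⟩ := exists_eq_single_add hl
      rw [add_assoc] at h
      obtain ⟨e, e', rfl, rfl, rfl⟩ := ih (add_left_cancel h)
      exact ⟨l ::ₘ e, e', by simp, rfl, by simp⟩
    · obtain ⟨a', rfl⟩ := exists_eq_single_add hl
      rw [add_left_comm] at h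
      obtain ⟨e, e', rfl, rfl, rfl⟩ := ih (add_left_cancel h)
      exact ⟨e, l ::ₘ e', rfl, by simp, by simp⟩

/-- Forgetting labels in favour of their values is additive, which gives one direction by
`Fill.sim`. Conversely, equal elements of a poly-term carry distinct labels, and these have to be
distributed among the occurrences; `Fill.sim_split` does so. -/
theorem mem_msubst {n : ℕ} {s : RTerm} {S : Fin n → RPoly} {v : RTerm} :
    v ∈ msubst s S ↔ Fill s (subEnv n) S v := by
  set φ : Label S → (Fin n → RPoly) := fun l => Pi.single l.1 {l.2.1} with hφ
  have h1 : v ∈ msubst s S ↔ Fill s (fun x a v => (v, a) ∈ candidates S x)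
      (Finset.univ : Finset (Label S)).val v := by
    rw [← mem_plug]
    simp [msubst]
  rw [h1]
  constructor
  · intro h
    obtain ⟨b, rfl, h⟩ := h.sim (Φ := fun a b => b = (a.map φ).sum) (d := subEnv n) (by simp)
      (by rintro _ _ _ _ rfl rfl; simp) (by
        intro x _ a v h
        refine ⟨_, rfl, ?_⟩
        unfold candidates at h
        unfold subEnv
        split_ifs at h ⊢ with hx
        · obtain ⟨l, _, hl⟩ := Multiset.mem_map.1 h
          simp only [Prod.mk.injEq] at hl
          obtain ⟨rfl, rfl⟩ := hl
          simp [hφ]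
        · simp only [Multiset.mem_singleton, Prod.mk.injEq] at h
          obtain ⟨rfl, rfl⟩ := h
          simp)
    rwa [hφ, sum_pi_single_map_univ] at h
  · intro h
    suffices h : ∃ v', Fill s (fun x a v => (v, a) ∈ candidates S x)
        (Finset.univ : Finset (Label S)).val v' ∧ v = v' by
      obtain ⟨_, h, rfl⟩ := h
      exact h
    refine h.sim_split (Θ := Eq)
      (Ψ := fun (a : Fin n → RPoly) (b : Multiset (Label S)) => a = (b.map φ).sum)
      ?_ ?_ rfl
      (by rintro _ _ rfl; rfl) (by rintro _ _ _ _ rfl h; rw [Multiset.rel_eq] at h; rw [h])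
      (by rintro _ _ rfl; rfl) ?_ (sum_pi_single_map_univ S).symm
    · exact fun hb => eq_zero_of_sum_single_eq_zero hb.symm
    · exact exists_split_of_sum_single_eq_add
    · intro x a b v h hb
      refine ⟨v, ?_, rfl⟩
      unfold subEnv at h
      unfold candidates
      split_ifs at h ⊢ with hx
      · subst h
        -- The values of `b` add up to a single element, so `b` consists of exactly one label.
        induction b using Multiset.induction_on with
        | empty => simp at hb
        | cons l b _ =>
          rw [Multiset.map_cons, Multiset.sum_cons] at hb
          obtain ⟨i, l⟩ := l
          have hi : l.1 ∈ (Pi.single ⟨x, hx⟩ {v} : Fin n → RPoly) i := by rw [hb]; simp [hφ]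
          by_cases hix : i = ⟨x, hx⟩
          · subst hix
            have hv : l.1 = v := by simpa using hi
            subst hv
            obtain rfl := eq_zero_of_sum_single_eq_zero (left_eq_add.1 hb)
            exact Multiset.mem_map.2 ⟨l, Finset.mem_univ _, rfl⟩
          · simp [hix] at hi
      · obtain ⟨rfl, rfl⟩ := h
        simp [eq_zero_of_sum_single_eq_zero hb.symm]

end Fill

end RTerm

namespace RTerm

/-! ### Reduction of single terms -/

/-- The environment of differential substitution for the variable `0`. -/
def betaEnv : ℕ → RPoly → RTerm → Prop
  | 0, a, v => a = {v}
  | k + 1, a, v => a = 0 ∧ v = var k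

theorem mem_msubst_one {s : RTerm} {S : RPoly} {v : RTerm} :
    (v ∈ msubst s fun _ : Fin 1 => S) ↔ Fill s betaEnv S v := by
  rw [mem_msubst]
  constructor
  · intro h
    obtain ⟨b, hb, h⟩ := h.sim (Φ := fun a b => b = a 0) (d := betaEnv) rfl
      (by rintro _ _ _ _ rfl rfl; rfl) (by
        rintro (_ | x) _ a v h
        · exact ⟨_, rfl, by simp [show a = _ from h, betaEnv]⟩
        · obtain ⟨rfl, rfl⟩ := h
          exact ⟨_, rfl, rfl, rfl⟩)
    rwa [hb] at h
  · intro h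
    obtain ⟨b, hb, h⟩ := h.sim (Φ := fun a (b : Fin 1 → RPoly) => b = fun _ => a) (d := subEnv 1)
      rfl (by rintro _ _ _ _ rfl rfl; rfl) (by
        rintro (_ | x) _ a v h
        · refine ⟨_, rfl, ?_⟩
          obtain rfl : a = {v} := h
          simp only [subEnv, Nat.zero_lt_one, dif_pos]
          funext i
          obtain rfl := Subsingleton.elim i 0
          rfl
        · obtain ⟨rfl, rfl⟩ := h
          exact ⟨_, rfl, by simp [subEnv]; rfl⟩)
    rwa [hb] at h

theorem fill_rename_succ_betaEnv {s : RTerm} {S : RPoly} {v : RTerm} :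
    Fill (rename s Nat.succ) betaEnv S v ↔ S = 0 ∧ v = s := by
  rw [fill_rename]
  -- On shifted variables `betaEnv` is definitionally `idEnv`.
  exact fill_idEnv s S v

/-- `Red1 s t`: the term `t` occurs in a one step reduct of `s`. -/
inductive Red1 : RTerm → RTerm → Prop
  | lam {s t : RTerm} : Red1 s t → Red1 (lam s) (lam t)
  | appL {s t : RTerm} (S : RPoly) : Red1 s t → Red1 (app s S) (app t S)
  | appR (s : RTerm) {u t : RTerm} (S : RPoly) :
      Red1 u t → Red1 (app s (u ::ₘ S)) (app s (t ::ₘ S))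
  | beta {s : RTerm} {S : RPoly} {v : RTerm} : Fill s betaEnv S v → Red1 (app (lam s) S) v

theorem red1_iff {s t : RTerm} : Red1 s t ↔ ∃ a, Step s a ∧ t ∈ a := by
  constructor
  · intro h
    induction h with
    | lam _ ih =>
      obtain ⟨a, h, ht⟩ := ih
      exact ⟨_, .lam h, Multiset.mem_map_of_mem _ ht⟩
    | appL S _ ih =>
      obtain ⟨a, h, ht⟩ := ih
      exact ⟨_, .appL S h, Multiset.mem_map_of_mem (fun t => app t S) ht⟩
    | appR s S _ ih =>
      obtain ⟨a, h, ht⟩ := ih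
      exact ⟨_, .appR s S h, Multiset.mem_map_of_mem (fun t => app s (t ::ₘ S)) ht⟩
    | beta h => exact ⟨_, .beta _ _, mem_msubst_one.2 h⟩
  · rintro ⟨a, h, ht⟩
    induction h generalizing t with
    | lam _ ih =>
      obtain ⟨t, ht', rfl⟩ := Multiset.mem_map.1 ht
      exact .lam (ih ht')
    | appL S _ ih =>
      obtain ⟨t, ht', rfl⟩ := Multiset.mem_map.1 ht
      exact .appL S (ih ht')
    | appR s S _ ih =>
      obtain ⟨t, ht', rfl⟩ := Multiset.mem_map.1 ht
      exact .appR s S (ih ht')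
    | beta => exact .beta (mem_msubst_one.1 ht)

theorem red1_lam {s t : RTerm} (h : Red1 (lam s) t) : ∃ s', Red1 s s' ∧ t = lam s' := by
  generalize hx : lam s = x at h
  cases h with
  | lam h => rw [lam_inj.1 hx]; exact ⟨_, h, rfl⟩
  | appL => simp at hx
  | appR => simp at hx
  | beta => simp at hx

theorem red1_app {s : RTerm} {S : RPoly} {t : RTerm} (h : Red1 (app s S) t) :
    (∃ s', Red1 s s' ∧ t = app s' S) ∨
    (∃ u u' T, S = u ::ₘ T ∧ Red1 u u' ∧ t = app s (u' ::ₘ T)) ∨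
    ∃ r, s = lam r ∧ Fill r betaEnv S t := by
  generalize hx : app s S = x at h
  cases h with
  | lam h => simp at hx
  | appL S h =>
    obtain ⟨rfl, rfl⟩ := app_inj.1 hx
    exact .inl ⟨_, h, rfl⟩
  | appR s S h =>
    obtain ⟨rfl, rfl⟩ := app_inj.1 hx
    exact .inr (.inl ⟨_, _, _, rfl, h, rfl⟩)
  | beta h =>
    obtain ⟨rfl, rfl⟩ := app_inj.1 hx
    exact .inr (.inr ⟨_, rfl, h⟩)

theorem not_red1_var {x : ℕ} {t : RTerm} : ¬ Red1 (var x) t := by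
  intro h
  generalize hx : var x = y at h
  cases h <;> simp at hx

/-- Coefficients in `ℕ` never cancel and summands reduce independently, so a summand can be traced
back along single steps. Conversely, one occurrence is reduced while the others are kept; the step
keeping everything accounts for reflexivity. -/
theorem below_iff {s t : RTerm} : Below t s ↔ Relation.ReflTransGen Red1 s t := by
  constructor
  · rintro ⟨a, h, ht⟩
    have step : ∀ {a b : Multiset RTerm}, ParStep a b → ∀ t ∈ b, ∃ s ∈ a,
        Relation.ReflTransGen Red1 s t := by
      rintro _ _ ⟨l, hl, rfl, rfl⟩ t ht
      obtain ⟨b, hb, ht⟩ := Multiset.mem_join.1 ht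
      obtain ⟨p, hp, rfl⟩ := Multiset.mem_map.1 hb
      refine ⟨p.1, Multiset.mem_map_of_mem _ hp, ?_⟩
      rcases hl p hp with h | h
      · rw [h, Multiset.mem_singleton] at ht
        rw [ht]
      · exact .single (red1_iff.2 ⟨_, h, ht⟩)
    suffices H : ∃ s' ∈ ({s} : Multiset RTerm), Relation.ReflTransGen Red1 s' t by
      simpa using H
    generalize ({s} : Multiset RTerm) = b at h
    induction h generalizing t with
    | single h => exact step h t ht
    | tail _ h ih =>
      obtain ⟨u, hu, h'⟩ := step h t ht
      obtain ⟨s, hs, h''⟩ := ih hu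
      exact ⟨s, hs, h''.trans h'⟩
  · intro h
    induction h with
    | refl =>
      refine ⟨{s}, .single ⟨{(s, {s})}, ?_, by simp, by simp⟩, by simp⟩
      intro p hp
      rw [Multiset.mem_singleton] at hp
      subst hp
      exact .inl rfl
    | @tail t u _ h ih =>
      obtain ⟨a, ha, ht⟩ := ih
      obtain ⟨b, hb, hu⟩ := red1_iff.1 h
      obtain ⟨a, rfl⟩ := Multiset.exists_cons_of_mem ht
      refine ⟨b + a, ha.tail ⟨(t, b) ::ₘ a.map fun x => (x, {x}), ?_, ?_, ?_⟩, by simp [hu]⟩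
      · intro p hp
        rcases Multiset.mem_cons.1 hp with rfl | hp
        · exact .inr hb
        · obtain ⟨x, _, rfl⟩ := Multiset.mem_map.1 hp
          exact .inl rfl
      · simp
      · simp [Multiset.map_map]

theorem Below.refl (s : RTerm) : Below s s := below_iff.2 .refl

theorem Below.trans {s t u : RTerm} (h : Below s t) (h' : Below t u) : Below s u :=
  below_iff.2 ((below_iff.1 h').trans (below_iff.1 h))

theorem Red1.toBelow {s t : RTerm} (h : Red1 s t) : Below t s := below_iff.2 (.single h)

theorem Below.lam {s t : RTerm} (h : Below s t) : Below (RTerm.lam s) (RTerm.lam t) :=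
  below_iff.2 ((below_iff.1 h).lift RTerm.lam fun _ _ => Red1.lam)

theorem Below.appL {s t : RTerm} (h : Below s t) (S : RPoly) : Below (app s S) (app t S) :=
  below_iff.2 ((below_iff.1 h).lift (fun s => app s S) fun _ _ => Red1.appL S)

theorem Below.appR (u : RTerm) {s t : RTerm} (h : Below s t) (S : RPoly) :
    Below (app u (s ::ₘ S)) (app u (t ::ₘ S)) :=
  below_iff.2 ((below_iff.1 h).lift (fun s => app u (s ::ₘ S)) fun _ _ => Red1.appR u S)

/-- Elementwise extension of `Below` to poly-terms. -/
abbrev BelowPoly : RPoly → RPoly → Prop := Multiset.Rel Below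

theorem BelowPoly.refl (S : RPoly) : BelowPoly S S :=
  Multiset.rel_refl_of_refl_on fun s _ => Below.refl s

theorem BelowPoly.trans {S T U : RPoly} (h : BelowPoly S T) (h' : BelowPoly T U) :
    BelowPoly S U := by
  have : IsTrans RTerm Below := ⟨fun _ _ _ => Below.trans⟩
  exact Multiset.Rel.trans _ h h'

theorem Below.app {s t : RTerm} {S T : RPoly} (h : Below s t) (hS : BelowPoly S T) :
    Below (app s S) (app t T) := by
  refine (h.appL S).trans ?_
  clear h
  -- The extra `U` holds the elements waiting while the others are replaced one by one.
  suffices ∀ U, Below (RTerm.app t (S + U)) (RTerm.app t (T + U)) by simpa using this 0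
  induction hS with
  | zero => exact fun U => .refl _
  | @cons a b S T hab _ ih =>
    intro U
    have h1 := ih (a ::ₘ U)
    rw [Multiset.add_cons, Multiset.add_cons] at h1
    simpa using h1.trans (hab.appR t (T + U))

theorem Red1.rename {s t : RTerm} (h : Red1 s t) (f : ℕ → ℕ) :
    Red1 (rename s f) (rename t f) := by
  induction h generalizing f with
  | lam _ ih => simpa using .lam (ih _)
  | appL S _ ih => simpa using .appL _ (ih _)
  | appR s S _ ih => simpa using .appR _ _ (ih _)
  | @beta s S v h =>
    rw [rename_app, rename_lam]
    refine .beta ?_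
    rw [fill_rename]
    -- Renaming the result of firing amounts to renaming the argument resources and lifting the
    -- renaming to the body.
    obtain ⟨_, rfl, h⟩ := ((fill_renEnv s f betaEnv S _).2 ⟨v, h, rfl⟩).sim
      (Φ := fun a b => b = a.map fun t => RTerm.rename t f)
      (d := fun x => betaEnv (liftRen f x)) rfl (by rintro _ _ _ _ rfl rfl; simp) (by
        rintro (_ | x) _ a _ ⟨w, h, rfl⟩
        · exact ⟨_, rfl, by simp [show a = _ from h, betaEnv, liftRen]⟩
        · exact ⟨_, rfl, by simp [h.1], by simp [h.2]⟩)
    exact h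

theorem Below.rename {s t : RTerm} (h : Below s t) (f : ℕ → ℕ) :
    Below (rename s f) (rename t f) :=
  below_iff.2 ((below_iff.1 h).lift (fun s => RTerm.rename s f) fun _ _ h => h.rename f)

theorem Red1.fv_subset {s t : RTerm} (h : Red1 s t) : fv t ⊆ fv s := by
  induction h with
  | lam _ ih => rw [fv_lam, fv_lam]; exact fun k hk => ih hk
  | appL S _ ih => rw [fv_app, fv_app]; exact fun k hk => hk.imp_left fun h => ih h
  | appR s S _ ih =>
    rw [fv_app, fv_app]
    rintro k (hk | ⟨t, ht, hk⟩)
    · exact .inl hk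
    · rcases Multiset.mem_cons.1 ht with rfl | ht
      · exact .inr ⟨_, Multiset.mem_cons_self _ _, ih hk⟩
      · exact .inr ⟨t, Multiset.mem_cons_of_mem ht, hk⟩
  | beta h =>
    rw [fv_app, fv_lam]
    intro k hk
    obtain ⟨x, hx, b, d, w, rfl, hc, hw⟩ := h.exists_of_mem_fv hk
    cases x with
    | zero =>
      obtain rfl : b = {w} := hc
      exact .inr ⟨w, by simp, hw⟩
    | succ x =>
      obtain ⟨rfl, rfl⟩ := hc
      obtain rfl : k = x := by simpa using hw
      exact .inl hx

theorem Below.fv_subset {s t : RTerm} (h : Below t s) : fv t ⊆ fv s := by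
  rw [below_iff] at h
  induction h with
  | refl => exact subset_rfl
  | tail _ h' ih => exact h'.fv_subset.trans ih

/-- Reduction steps can be postponed after fillings. -/
theorem Red1.exists_fill {u u' : RTerm} (h : Red1 u u') {A : Type} [AddCommMonoid A] :
    ∀ {c : ℕ → A → RTerm → Prop} {a : A} {v' : RTerm}, Fill u' c a v' →
      ∃ v, Fill u c a v ∧ Red1 v v' := by
  induction h with
  | lam _ ih =>
    intro c a v' h
    obtain ⟨w', hw', rfl⟩ := (fill_lam _ _ _ _).1 h
    obtain ⟨w, hw, h⟩ := ih hw'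
    exact ⟨_, (fill_lam _ _ _ _).2 ⟨w, hw, rfl⟩, .lam h⟩
  | appL S _ ih =>
    intro c a v' h
    obtain ⟨b, w', d, W, hw', hW, rfl, rfl⟩ := (fill_app _ _ _ _ _).1 h
    obtain ⟨w, hw, h⟩ := ih hw'
    exact ⟨_, (fill_app _ _ _ _ _).2 ⟨_, w, _, _, hw, hW, rfl, rfl⟩, .appL _ h⟩
  | appR s S _ ih =>
    intro c a v' h
    obtain ⟨b, w, d, W, hw, hW, rfl, rfl⟩ := (fill_app _ _ _ _ _).1 h
    obtain ⟨d, z', e, Z, hz', hZ, rfl, rfl⟩ := (fillPoly_cons_left _ _ _ _ _).1 hW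
    obtain ⟨z, hz, h⟩ := ih hz'
    exact ⟨_, (fill_app _ _ _ _ _).2 ⟨_, w, _, _, hw,
      (fillPoly_cons_left _ _ _ _ _).2 ⟨_, z, _, _, hz, hZ, rfl, rfl⟩, rfl, rfl⟩, .appR _ _ h⟩
  | @beta s S u hs =>
    intro c a v' h
    -- Exchanges firing then filling with filling then firing. The relation on labels says that the
    -- old resources `S` are filled into `R` at cost `d`, and that `a` is `d` plus the cost `b` of
    -- filling the body.
    obtain ⟨⟨b, R⟩, ⟨d, had, hR⟩, hf⟩ := ((fill_compEnv s betaEnv c (S, a) v').2 ⟨u, hs, h⟩).sim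
      (Φ := fun p q => ∃ d, p.2 = q.1 + d ∧ FillPoly p.1 c d q.2)
      (d := compEnv (liftEnv c) betaEnv) ⟨0, by simp, by simp⟩
      (by
        rintro ⟨p, p'⟩ ⟨q, q'⟩ ⟨r, r'⟩ ⟨s, s'⟩ ⟨d, rfl, h⟩ ⟨d', rfl, h'⟩
        exact ⟨d + d', add_add_add_comm _ _ _ _, h.add h'⟩)
      (by
        rintro (_ | x) _ ⟨R, b⟩ w ⟨t, ht, hw⟩
        · obtain rfl : R = {t} := ht
          refine ⟨((0 : A), ({w} : RPoly)), ⟨b, (zero_add b).symm, ?_⟩, var 0, ⟨rfl, rfl⟩,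
            (fill_var _ _ _ _).2 rfl⟩
          exact (fillPoly_cons_left _ _ _ _ _).2 ⟨b, w, 0, 0, hw,
            (fillPoly_zero _ _ _).2 ⟨rfl, rfl⟩, (add_zero b).symm, rfl⟩
        · obtain ⟨h1, rfl⟩ := ht
          obtain rfl : R = 0 := h1
          exact ⟨(b, 0), ⟨0, by simp, by simp⟩, _, ⟨w, (fill_var _ _ _ _).1 hw, rfl⟩,
            fill_rename_succ_betaEnv.2 ⟨rfl, rfl⟩⟩)
    obtain ⟨r, hr, hrv⟩ := (fill_compEnv _ _ _ _ _).1 hf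
    exact ⟨_, (fill_app _ _ _ _ _).2 ⟨b, _, d, R, (fill_lam _ _ _ _).2 ⟨r, hr, rfl⟩, hR, had, rfl⟩,
      .beta hrv⟩

/-- Steps inside a redex can be done after firing it: those in the body by `Red1.exists_fill`, those
in the arguments because `Below` is a congruence stable under renaming. -/
theorem Below.exists_fill {u u' : RTerm} (h : Below u' u) {S S' : RPoly} (hS : BelowPoly S' S)
    {v' : RTerm} (h' : Fill u' betaEnv S' v') : ∃ v, Fill u betaEnv S v ∧ Below v' v := by
  have h1 : ∃ v, Fill u betaEnv S' v ∧ Below v' v := by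
    rw [below_iff] at h
    induction h generalizing v' with
    | refl => exact ⟨v', h', .refl _⟩
    | tail _ h ih =>
      obtain ⟨v, hv, hr⟩ := h.exists_fill h'
      obtain ⟨w, hw, hr'⟩ := ih hv
      exact ⟨w, hw, hr.toBelow.trans hr'⟩
  obtain ⟨v, hv, hr⟩ := h1
  obtain ⟨w, hw, hr'⟩ := hv.sim_split (Ψ := BelowPoly) (Θ := Below) (d := betaEnv) (b := S)
    (fun h => Multiset.rel_zero_left.1 h)
    (fun h => Multiset.rel_add_left.1 h) (.refl _) Below.lam Below.app (fun h => h.rename _)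
    (by
      rintro (_ | x) a b v h hab
      · obtain rfl : a = {v} := h
        obtain ⟨w, T, hw, hT, rfl⟩ := Multiset.rel_cons_left.1 hab
        rw [Multiset.rel_zero_left.1 hT]
        exact ⟨w, rfl, hw⟩
      · obtain ⟨rfl, rfl⟩ := h
        exact ⟨_, ⟨Multiset.rel_zero_left.1 hab, rfl⟩, .refl _⟩) hS
  exact ⟨w, hw, hr.trans hr'⟩

/-- A value `w` can only be inserted at the variable `0` with label `{w}`, or, if `w` is `var k`, at
`k + 1` with label `0`; so `finite_setOf_fill` applies. -/
theorem finite_setOf_fill_betaEnv (v : RTerm) :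
    {p : RTerm × RPoly | Fill p.1 betaEnv p.2 v}.Finite := by
  refine finite_setOf_fill v betaEnv fun w => ?_
  have : {p : ℕ × RPoly | betaEnv p.1 p.2 w} ⊆
      {(0, {w})} ∪ (fun k => (k + 1, (0 : RPoly))) '' {k | w = var k} := by
    rintro ⟨_ | x, a⟩ h
    · exact .inl (Prod.ext rfl h)
    · exact .inr ⟨x, h.2, Prod.ext rfl h.1.symm⟩
  refine Set.Finite.subset ((Set.finite_singleton _).union (Set.Finite.image _ ?_)) this
  exact Set.Subsingleton.finite fun k hk l hl => var_inj.1 (hk.symm.trans hl)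

/-! ### Spines -/

/-- `⟨…⟨s⟩S₁…⟩Sₖ`, the last argument coming first in the list. -/
noncomputable def spine (s : RTerm) : List RPoly → RTerm
  | [] => s
  | S :: Ss => app (spine s Ss) S

/-- Equal lengths are needed because a head may itself be an application. -/
theorem spine_inj {s t : RTerm} : ∀ {Ss Ts : List RPoly}, Ss.length = Ts.length →
    spine s Ss = spine t Ts → s = t ∧ Ss = Ts
  | [], [], _, h => ⟨h, rfl⟩
  | S :: Ss, T :: Ts, hl, h => by
    obtain ⟨h1, rfl⟩ := app_inj.1 h
    obtain ⟨rfl, rfl⟩ := spine_inj (by simpa using hl) h1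
    exact ⟨rfl, rfl⟩

theorem Below.spine {s t : RTerm} (h : Below s t) {Ss Ts : List RPoly}
    (hS : List.Forall₂ BelowPoly Ss Ts) : Below (spine s Ss) (spine t Ts) := by
  induction hS with
  | nil => exact h
  | cons h' _ ih => exact ih.app h'

theorem spine_ne_lam {s : RTerm} (h : ∀ r, s ≠ lam r) : ∀ (Ss : List RPoly) (r : RTerm),
    spine s Ss ≠ lam r
  | [], r => h r
  | _ :: _, _ => app_ne_lam

theorem forall₂_belowPoly_refl : ∀ Ss : List RPoly, List.Forall₂ BelowPoly Ss Ss
  | [] => .nil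
  | S :: Ss => .cons (.refl S) (forall₂_belowPoly_refl Ss)

/-- A step from a spine whose head is not an abstraction is in the head or in an argument. -/
theorem red1_spine {s : RTerm} (hs : ∀ r, s ≠ lam r) : ∀ {Ss : List RPoly} {t : RTerm},
    Red1 (spine s Ss) t → (∃ s', Red1 s s' ∧ t = spine s' Ss) ∨
      ∃ Ts, List.Forall₂ BelowPoly Ts Ss ∧ t = spine s Ts
  | [], t, h => .inl ⟨t, h, rfl⟩
  | S :: Ss, t, h => by
    rcases red1_app h with ⟨s', hs', rfl⟩ | ⟨u, u', T, rfl, hu, rfl⟩ | ⟨r, hr, _⟩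
    · rcases red1_spine hs hs' with ⟨s', h', rfl⟩ | ⟨Ts, h', rfl⟩
      · exact .inl ⟨s', h', rfl⟩
      · exact .inr ⟨S :: Ts, .cons (BelowPoly.refl S) h', rfl⟩
    · exact .inr ⟨(u' ::ₘ T) :: Ss,
        .cons (.cons hu.toBelow (BelowPoly.refl T)) (forall₂_belowPoly_refl Ss), rfl⟩
    · exact absurd hr (spine_ne_lam hs _ _)

theorem forall₂_belowPoly_trans {Ss Ts Us : List RPoly} (h : List.Forall₂ BelowPoly Ss Ts)
    (h' : List.Forall₂ BelowPoly Ts Us) : List.Forall₂ BelowPoly Ss Us := by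
  induction h generalizing Us with
  | nil => exact h'
  | cons h1 _ ih =>
    cases h' with
    | cons h2 h3 => exact .cons (h1.trans h2) (ih h3)

theorem below_spine_var {x : ℕ} {Ss : List RPoly} {t : RTerm} (h : Below t (spine (var x) Ss)) :
    ∃ Ts, List.Forall₂ BelowPoly Ts Ss ∧ t = spine (var x) Ts := by
  rw [below_iff] at h
  induction h with
  | refl => exact ⟨Ss, forall₂_belowPoly_refl Ss, rfl⟩
  | tail _ h ih =>
    obtain ⟨Ts, hT, rfl⟩ := ih
    rcases red1_spine (fun _ => var_ne_lam) h with ⟨s', h, _⟩ | ⟨Us, hU, rfl⟩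
    · exact absurd h not_red1_var
    · exact ⟨Us, forall₂_belowPoly_trans hU hT, rfl⟩

/-- A reduction from a spine headed by a redex either is internal or can start by firing it. -/
theorem below_spine_redex {u : RTerm} {S : RPoly} {Ss : List RPoly} {t : RTerm}
    (h : Below t (spine (app (lam u) S) Ss)) :
    (∃ v, Fill u betaEnv S v ∧ Below t (spine v Ss)) ∨
    ∃ u' S' Ts, Below u' u ∧ BelowPoly S' S ∧ List.Forall₂ BelowPoly Ts Ss ∧
      t = spine (app (lam u') S') Ts := by
  rw [below_iff] at h
  induction h with
  | refl => exact .inr ⟨u, S, Ss, .refl _, .refl _, forall₂_belowPoly_refl Ss, rfl⟩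
  | tail _ hr ih =>
    rcases ih with ⟨v, hv, h⟩ | ⟨u', S', Ts, h1, h2, h3, rfl⟩
    · exact .inl ⟨v, hv, hr.toBelow.trans h⟩
    · rcases red1_spine (fun _ => app_ne_lam) hr with ⟨s', hs', rfl⟩ | ⟨Us, hU, rfl⟩
      · rcases red1_app hs' with ⟨s', h, rfl⟩ | ⟨w, w', T, rfl, h, rfl⟩ | ⟨r, hr, h⟩
        · obtain ⟨u'', hu, rfl⟩ := red1_lam h
          exact .inr ⟨u'', S', Ts, hu.toBelow.trans h1, h2, h3, rfl⟩
        · exact .inr ⟨u', w' ::ₘ T, Ts, h1,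
            BelowPoly.trans (.cons h.toBelow (BelowPoly.refl T)) h2, h3, rfl⟩
        · obtain rfl := lam_inj.1 hr
          -- The redex fires after some internal steps; it is fired first instead, and those steps
          -- follow.
          obtain ⟨v, hv, h⟩ := h1.exists_fill h2 h
          exact .inl ⟨v, hv, h.spine h3⟩
      · exact .inr ⟨u', S', Us, h1, h2, forall₂_belowPoly_trans hU h3, rfl⟩

end RTerm

namespace RTerm

/-! ### The basic finiteness structure -/

/-- The free variables of a set of terms. -/
def fvs (e : Set RTerm) : Set ℕ := ⋃ s ∈ e, fv s

theorem mem_fvs {e : Set RTerm} {x : ℕ} : x ∈ fvs e ↔ ∃ s ∈ e, x ∈ fv s := by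
  simp [fvs]

/-- Choosing for each free variable of `e` a term of `e` containing it gives a thin set: terms with
free variables in `ξ` were chosen for elements of `ξ`. Orthogonality makes this choice finite, and
each term has finitely many free variables. -/
theorem mem_orth_fvThin {e : Set RTerm} : e ∈ orth Set.univ fvThin ↔ (fvs e).Finite := by
  constructor
  · rintro ⟨_, h⟩
    have hc : ∀ y : fvs e, ∃ s ∈ e, y.1 ∈ fv s := fun y => mem_fvs.1 y.2
    choose s hs hy using hc
    have hthin : Set.range s ∈ fvThin := by
      intro ξ
      refine ((ξ.finite_toSet.preimage Subtype.val_injective.injOn).image s).subset ?_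
      rintro _ ⟨⟨y, rfl⟩, h⟩
      exact ⟨y, h (hy y), rfl⟩
    have hfin := h _ hthin
    refine (hfin.biUnion fun s _ => finite_fv s).subset fun y hye => ?_
    exact Set.mem_biUnion ⟨⟨⟨y, hye⟩, rfl⟩, hs _⟩ (hy ⟨y, hye⟩)
  · refine fun h => ⟨Set.subset_univ _, fun e' he' => (he' h.toFinset).subset ?_⟩
    rintro s ⟨hs, hse⟩
    refine ⟨hs, fun x hx => ?_⟩
    rw [Set.Finite.coe_toFinset]
    exact mem_fvs.2 ⟨s, hse, hx⟩

theorem mem_nfv {e : Set RTerm} :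
    e ∈ Nfv ↔ (∀ t, {s ∈ e | Below t s}.Finite) ∧ (fvs e).Finite := by
  unfold Nfv Nfin
  rw [Set.mem_inter_iff, mem_orth_fvThin]
  refine and_congr_left fun _ => ?_
  simp only [orth, Set.mem_ofPred_eq, Set.subset_univ, true_and, Set.forall_mem_range]
  refine forall_congr' fun t => ?_
  rw [Set.inter_comm]
  rfl

theorem mem_nfv_of_subset {e f : Set RTerm} (h : f ∈ Nfv) (hef : e ⊆ f) : e ∈ Nfv := by
  rw [mem_nfv] at h ⊢
  refine ⟨fun t => (h.1 t).subset fun s hs => ⟨hef hs.1, hs.2⟩, h.2.subset fun x hx => ?_⟩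
  obtain ⟨s, hs, hx⟩ := mem_fvs.1 hx
  exact mem_fvs.2 ⟨s, hef hs, hx⟩

theorem fvs_appSet_subset (f e : Set RTerm) : fvs (appSet f (prom e)) ⊆ fvs f ∪ fvs e := by
  intro x hx
  obtain ⟨_, ⟨s, hs, S, hS, rfl⟩, hx⟩ := mem_fvs.1 hx
  rw [fv_app] at hx
  rcases hx with hx | ⟨t, ht, hx⟩
  · exact .inl (mem_fvs.2 ⟨s, hs, hx⟩)
  · exact .inr (mem_fvs.2 ⟨t, hS t ht, hx⟩)

theorem fvs_lamSet_subset (f : Set RTerm) : fvs (lamSet f) ⊆ Nat.succ ⁻¹' fvs f := by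
  intro x hx
  obtain ⟨_, ⟨s, hs, rfl⟩, hx⟩ := mem_fvs.1 hx
  exact mem_fvs.2 ⟨s, hs, by simpa using hx⟩

theorem appsSet_append_singleton (f : Set RTerm) (es : List (Set RTerm)) (e : Set RTerm) :
    appsSet f (es ++ [e]) = appSet (appsSet f es) (prom e) := by
  simp [appsSet]

theorem finite_fvs_appsSet {f : Set RTerm} (hf : (fvs f).Finite) (es : List (Set RTerm))
    (hes : ∀ e ∈ es, e ∈ Nfv) : (fvs (appsSet f es)).Finite := by
  induction es using List.reverseRecOn with
  | nil => exact hf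
  | append_singleton es e ih =>
    rw [appsSet_append_singleton]
    exact ((ih fun e he => hes e (by simp [he])).union (mem_nfv.1 (hes e (by simp))).2).subset
      (fvs_appSet_subset _ _)

/-- The list is reversed because `spine` puts the last argument first. -/
theorem mem_appsSet {f : Set RTerm} {es : List (Set RTerm)} {t : RTerm} :
    t ∈ appsSet f es ↔ ∃ s ∈ f, ∃ Ss, List.Forall₂ (fun S e => S ∈ prom e) Ss es.reverse ∧
      t = spine s Ss := by
  induction es using List.reverseRecOn generalizing t with
  | nil =>
    constructor
    · exact fun h => ⟨t, h, [], .nil, rfl⟩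
    · rintro ⟨s, hs, Ss, h, rfl⟩
      cases h
      exact hs
  | append_singleton es e ih =>
    rw [appsSet_append_singleton, List.reverse_append]
    constructor
    · rintro ⟨w, hw, S, hS, rfl⟩
      obtain ⟨s, hs, Ss, h, rfl⟩ := ih.1 hw
      exact ⟨s, hs, S :: Ss, .cons hS h, rfl⟩
    · rintro ⟨s, hs, Ss, h, rfl⟩
      obtain ⟨S, Ss, h1, h2, rfl⟩ := List.forall₂_cons_right_iff.1 h
      exact ⟨_, ih.2 ⟨s, hs, Ss, h2, rfl⟩, S, h1, rfl⟩

/-- A poly-term above `T` is obtained by choosing, for each element of `T`, one of the finitely many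
terms of `e` above it. -/
theorem finite_setOf_belowPoly {e : Set RTerm} (he : ∀ t, {s ∈ e | Below t s}.Finite)
    (T : RPoly) : {S ∈ prom e | BelowPoly T S}.Finite := by
  induction T using Multiset.induction_on with
  | empty =>
    refine (Set.finite_singleton 0).subset ?_
    rintro S ⟨_, h⟩
    exact Multiset.rel_zero_left.1 h
  | cons t T ih =>
    refine (((he t).prod ih).image fun p => p.1 ::ₘ p.2).subset ?_
    rintro S ⟨hS, h⟩
    obtain ⟨s, S, h1, h2, rfl⟩ := Multiset.rel_cons_left.1 h
    exact ⟨(s, S), ⟨⟨hS s (by simp), h1⟩, fun t ht => hS t (by simp [ht]), h2⟩, rfl⟩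

theorem finite_setOf_forall₂_belowPoly (Ts : List RPoly) : ∀ es : List (Set RTerm),
    (∀ e ∈ es, e ∈ Nfv) →
    {Ss | List.Forall₂ (fun S e => S ∈ prom e) Ss es ∧ List.Forall₂ BelowPoly Ts Ss}.Finite := by
  induction Ts with
  | nil =>
    refine fun es _ => (Set.finite_singleton []).subset ?_
    rintro Ss ⟨_, h⟩
    exact List.forall₂_nil_left_iff.1 h
  | cons T Ts ih =>
    rintro (_ | ⟨e, es⟩) hes
    · refine (Set.finite_singleton []).subset ?_
      rintro Ss ⟨h, _⟩
      exact List.forall₂_nil_right_iff.1 h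
    · refine (((finite_setOf_belowPoly (mem_nfv.1 (hes e (by simp))).1 T).prod
        (ih es fun e he => hes e (by simp [he]))).image fun p => p.1 :: p.2).subset ?_
      rintro Ss ⟨h, h'⟩
      obtain ⟨S, Ss, h1, h2, rfl⟩ := List.forall₂_cons_right_iff.1 h
      obtain ⟨h3, h4⟩ := List.forall₂_cons.1 h'
      exact ⟨(S, Ss), ⟨⟨h1, h3⟩, h2, h4⟩, rfl⟩

/-- A head variable confines reduction to the arguments, so counting terms above `t` reduces to
counting argument lists. -/
theorem varSets_subset_nfv : ResSpace.varSets ⊆ Nfv := by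
  rintro _ ⟨x, es, hes, rfl⟩
  refine mem_nfv.2 ⟨fun t => ?_, finite_fvs_appsSet ?_ es hes⟩
  · have hes' : ∀ e ∈ es.reverse, e ∈ Nfv := fun e he => hes e (by simpa using he)
    rcases Set.eq_empty_or_nonempty {s ∈ appsSet {var x} es | Below t s} with h | ⟨_, h, ht⟩
    · rw [h]; exact Set.finite_empty
    obtain ⟨_, rfl, Ss, hS, rfl⟩ := mem_appsSet.1 h
    obtain ⟨Ts, hT, rfl⟩ := below_spine_var ht
    refine ((finite_setOf_forall₂_belowPoly Ts _ hes').image (spine (var x))).subset ?_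
    rintro _ ⟨h', ht'⟩
    obtain ⟨_, rfl, Ss', hS', rfl⟩ := mem_appsSet.1 h'
    obtain ⟨Ts', hT', h''⟩ := below_spine_var ht'
    have hl : Ts.length = Ts'.length := by
      rw [hT.length_eq, hT'.length_eq, hS.length_eq, hS'.length_eq]
    obtain rfl := (spine_inj hl h'').2
    exact ⟨Ss', ⟨hS', hT'⟩, rfl⟩
  · refine (finite_fv (var x)).subset fun y hy => ?_
    obtain ⟨_, rfl, h⟩ := mem_fvs.1 hy
    exact h

/-- Terms above `t` are sorted by `below_spine_redex`: those from which `t` is reachable by firing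
first, and those for which `t` retains the redex. Free variables are controlled by those of `g`, `e`
and `es`. -/
theorem nfv_expansion {g e : Set RTerm} (hg : g ∈ Nfv) (he : e ∈ Nfv) {es : List (Set RTerm)}
    (hes : ∀ e' ∈ es, e' ∈ Nfv)
    (h : appsSet (msubstSet g fun _ : Fin 1 => prom e) es ∈ Nfv) :
    appsSet (appSet (lamSet g) (prom e)) es ∈ Nfv := by
  have hes' : ∀ e ∈ es.reverse, e ∈ Nfv := fun e he => hes e (by simpa using he)
  refine mem_nfv.2 ⟨fun t => ?_, finite_fvs_appsSet (((Set.Finite.preimage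
    Nat.succ_injective.injOn (mem_nfv.1 hg).2).union (mem_nfv.1 he).2).subset
    ((fvs_appSet_subset _ _).trans (Set.union_subset_union_left _ (fvs_lamSet_subset _)))) es hes⟩
  have hmem : ∀ {w}, w ∈ appsSet (appSet (lamSet g) (prom e)) es → ∃ u ∈ g, ∃ S ∈ prom e, ∃ Ss,
      List.Forall₂ (fun S e => S ∈ prom e) Ss es.reverse ∧ w = spine (app (lam u) S) Ss := by
    intro w hw
    obtain ⟨_, ⟨_, ⟨u, hu, rfl⟩, S, hS, rfl⟩, Ss, hSs, rfl⟩ := mem_appsSet.1 hw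
    exact ⟨u, hu, S, hS, Ss, hSs, rfl⟩
  have hlen : ∀ {Ss : List RPoly}, List.Forall₂ (fun S e => S ∈ prom e) Ss es.reverse →
      Ss.length = es.length := fun h => by simpa using h.length_eq
  have h1 : {w | ∃ u ∈ g, ∃ S ∈ prom e, ∃ Ss, List.Forall₂ (fun S e => S ∈ prom e) Ss es.reverse ∧
      w = spine (app (lam u) S) Ss ∧ ∃ v, Fill u betaEnv S v ∧ Below t (spine v Ss)}.Finite := by
    have hZ := (mem_nfv.1 h).1 t
    -- With the number of arguments fixed, a term splits as a spine in at most one way, so there are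
    -- finitely many pairs of a fired head and an argument list.
    have hZ' : {p : RTerm × List RPoly | p.2.length = es.length ∧ spine p.1 p.2 ∈
        {s ∈ appsSet (msubstSet g fun _ : Fin 1 => prom e) es | Below t s}}.Finite := by
      refine Set.Finite.of_finite_image (f := fun p => spine p.1 p.2) (hZ.subset ?_) ?_
      · rintro _ ⟨p, hp, rfl⟩
        exact hp.2
      · intro p hp q hq hpq
        obtain ⟨h1, h2⟩ := spine_inj (hp.1.trans hq.1.symm) hpq
        exact Prod.ext h1 h2
    refine (hZ'.biUnion fun p _ => (finite_setOf_fill_betaEnv p.1).image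
      fun q => spine (app (lam q.1) q.2) p.2).subset ?_
    rintro _ ⟨u, hu, S, hS, Ss, hSs, rfl, v, hv, ht⟩
    refine Set.mem_biUnion (x := (v, Ss)) ⟨hlen hSs, mem_appsSet.2 ⟨v, ?_, Ss, hSs, rfl⟩, ht⟩
      ⟨(u, S), hv, rfl⟩
    exact ⟨u, hu, fun _ => S, fun _ => hS, mem_msubst_one.2 hv⟩
  -- Here `t` determines `u'`, `S'` and `Ts`, and each has finitely many terms above it in its own
  -- set.
  have h2 : {w | ∃ u ∈ g, ∃ S ∈ prom e, ∃ Ss, List.Forall₂ (fun S e => S ∈ prom e) Ss es.reverse ∧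
      w = spine (app (lam u) S) Ss ∧ ∃ u' S' Ts, Below u' u ∧ BelowPoly S' S ∧
        List.Forall₂ BelowPoly Ts Ss ∧ t = spine (app (lam u') S') Ts}.Finite := by
    rcases Set.eq_empty_or_nonempty {w | ∃ u ∈ g, ∃ S ∈ prom e, ∃ Ss,
      List.Forall₂ (fun S e => S ∈ prom e) Ss es.reverse ∧
      w = spine (app (lam u) S) Ss ∧ ∃ u' S' Ts, Below u' u ∧ BelowPoly S' S ∧
        List.Forall₂ BelowPoly Ts Ss ∧ t = spine (app (lam u') S') Ts} with h0 | h0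
    · rw [h0]; exact Set.finite_empty
    obtain ⟨_, _, _, _, _, Ss₀, hSs₀, _, u', S', Ts, _, _, hT₀, rfl⟩ := h0
    refine ((((mem_nfv.1 hg).1 u').prod ((finite_setOf_belowPoly (mem_nfv.1 he).1 S').prod
      (finite_setOf_forall₂_belowPoly Ts _ hes'))).image
      fun p => spine (app (lam p.1) p.2.1) p.2.2).subset ?_
    rintro _ ⟨u, hu, S, hS, Ss, hSs, rfl, u'', S'', Ts', h3, h4, h5, h6⟩
    have hl : Ts.length = Ts'.length := by
      rw [hT₀.length_eq, h5.length_eq, hlen hSs₀, hlen hSs]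
    obtain ⟨h7, rfl⟩ := spine_inj hl h6
    obtain ⟨h8, rfl⟩ := app_inj.1 h7
    obtain rfl := lam_inj.1 h8
    exact ⟨(u, S, Ss), ⟨⟨hu, h3⟩, ⟨hS, h4⟩, hSs, h5⟩, rfl⟩
  refine (h1.union h2).subset ?_
  rintro _ ⟨hw, ht⟩
  obtain ⟨u, hu, S, hS, Ss, hSs, rfl⟩ := hmem hw
  rcases below_spine_redex ht with h | h
  · exact .inl ⟨u, hu, S, hS, Ss, hSs, rfl, h⟩
  · exact .inr ⟨u, hu, S, hS, Ss, hSs, rfl, h⟩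

end RTerm

open RTerm

/-! ### Orthogonality -/

theorem mem_orth_orth_of_subset {α : Type} {W : Set α} {F : Set (Set α)} {e f : Set α}
    (he : e ∈ orth W (orth W F)) (hfe : f ⊆ e) : f ∈ orth W (orth W F) :=
  ⟨hfe.trans he.1, fun e' he' => (he.2 e' he').subset (Set.inter_subset_inter_right _ hfe)⟩

theorem subset_orth_orth {α : Type} {W : Set α} {F : Set (Set α)} (hF : ∀ e ∈ F, e ⊆ W) :
    F ⊆ orth W (orth W F) :=
  fun e he => ⟨hF e he, fun e' he' => by rw [Set.inter_comm]; exact he'.2 e he⟩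

/-! ### Finiteness spaces and stability of saturation. -/

namespace ResSpace

theorem IsFinitenessSpace.mem_iff {X : ResSpace} (hX : X.IsFinitenessSpace) {e : Set RTerm} :
    e ∈ X.fin ↔ e ∈ orth X.web (orth X.web X.fin) :=
  ⟨fun h => subset_orth_orth hX.1 h, fun h => hX.2 h⟩

theorem IsFinitenessSpace.mem_of_subset {X : ResSpace} (hX : X.IsFinitenessSpace)
    {e f : Set RTerm} (he : e ∈ X.fin) (hfe : f ⊆ e) : f ∈ X.fin :=
  hX.2 (mem_orth_orth_of_subset (hX.mem_iff.1 he) hfe)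

/-- Used for application: the argument is a finite linear combination, so the shapes of its summands
have their union in the structure. -/
theorem IsFinitenessSpace.finite_union_mem {X : ResSpace} (hX : X.IsFinitenessSpace)
    {ι : Type*} (I : Finset ι) {e : ι → Set RTerm} (he : ∀ i ∈ I, e i ∈ X.fin) :
    (⋃ i ∈ I, e i) ∈ X.fin := by
  refine hX.2 ⟨Set.iUnion₂_subset fun i hi => hX.1 _ (he i hi), fun e' he' => ?_⟩
  rw [Set.inter_iUnion₂]
  exact I.finite_toSet.biUnion fun i hi => (hX.mem_iff.1 (he i hi)).2 e' he'

theorem IsFinitenessSpace.empty_mem {X : ResSpace} (hX : X.IsFinitenessSpace) : ∅ ∈ X.fin :=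
  hX.2 ⟨Set.empty_subset _, fun _ _ => by simp⟩

/-- The space of all simple terms, with the structure `Nfv`. -/
def nfvSpace : ResSpace where
  web := Set.univ
  fin := Nfv

theorem isSaturated_nfvSpace : nfvSpace.IsSaturated where
  isFinitenessSpace := by
    refine ⟨fun e _ => Set.subset_univ e, fun e he => ?_⟩
    -- `Nfv` is the orthogonal of this collection, hence closed under biorthogonality.
    have h : ∀ f ∈ Set.range up ∪ fvThin, f ∈ orth Set.univ Nfv := by
      refine fun f hf => ⟨Set.subset_univ _, fun e' he' => ?_⟩
      rw [Set.inter_comm]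
      rcases hf with hf | hf
      · exact he'.1.2 f hf
      · exact he'.2.2 f hf
    exact ⟨⟨Set.subset_univ _, fun f hf => he.2 f (h f (.inl hf))⟩,
      ⟨Set.subset_univ _, fun f hf => he.2 f (h f (.inr hf))⟩⟩
  varSets_subset := varSets_subset_nfv
  subset_nfv := subset_rfl
  expansion := fun _ hg _ he _ hes h => nfv_expansion hg he hes h

theorem appSet_mono {f g : Set RTerm} (h : f ⊆ g) (E : Set RPoly) : appSet f E ⊆ appSet g E :=
  Set.image2_subset_right h

/-- The web condition is automatic: singletons of elements of `g` inherit the property, since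
`Y.fin` is closed under subsets. -/
theorem mem_impl_fin {X Y : ResSpace} (hY : Y.IsFinitenessSpace) {g : Set RTerm} :
    g ∈ (X.impl Y).fin ↔ ∀ e ∈ X.fin, appSet g (prom e) ∈ Y.fin := by
  refine ⟨fun h => h.2, fun h => ⟨fun t ht e he => ?_, h⟩⟩
  exact hY.mem_of_subset (h e he) (appSet_mono (Set.singleton_subset_iff.2 ht) _)

/-- Fix `e'` orthogonal to `Y.fin`. The heads in the web that yield an element of `e'` form a set
orthogonal to the arrow structure, so `g` has finitely many of them; each contributes finitely many
arguments by the definition of the web. -/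
theorem isFinitenessSpace_impl {X Y : ResSpace} (hY : Y.IsFinitenessSpace) :
    (X.impl Y).IsFinitenessSpace := by
  refine ⟨fun e he => he.1, fun g hg => (mem_impl_fin hY).2 fun e he => hY.2 ⟨?_, ?_⟩⟩
  · rintro _ ⟨s, hs, S, hS, rfl⟩
    exact hY.1 _ (hg.1 hs e he) ⟨s, rfl, S, hS, rfl⟩
  · intro e' he'
    have hfin : ∀ s ∈ (X.impl Y).web, {S ∈ prom e | app s S ∈ e'}.Finite := by
      intro s hs
      have h1 := (hY.mem_iff.1 (hs e he)).2 e' he'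
      refine Set.Finite.of_finite_image (f := app s) (h1.subset ?_) fun S _ T _ h => (app_inj.1 h).2
      rintro _ ⟨S, hS, rfl⟩
      exact ⟨hS.2, s, rfl, S, hS.1, rfl⟩
    have h2 : {s ∈ (X.impl Y).web | ∃ S ∈ prom e, app s S ∈ e'} ∈
        orth (X.impl Y).web (X.impl Y).fin := by
      refine ⟨fun s hs => hs.1, fun f hf => ?_⟩
      have h4 := (hY.mem_iff.1 (hf.2 e he)).2 e' he'
      -- Projection to the head of an application; the value on other terms is irrelevant.
      refine ((h4.image fun w => match w.dest with
        | .app s _ => s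
        | _ => w).subset ?_)
      rintro s ⟨hs, _, S, hS, hS'⟩
      exact ⟨app s S, ⟨hS', s, hs, S, hS, rfl⟩, by simp⟩
    have h3 := hg.2 _ h2
    refine (h3.biUnion fun s hs => (hfin s hs.1.1).image (app s)).subset ?_
    rintro _ ⟨h4, s, hs, S, hS, rfl⟩
    exact Set.mem_biUnion (x := s) ⟨⟨hg.1 hs, S, hS, h4⟩, hs⟩ ⟨S, ⟨hS, h4⟩, rfl⟩

/-- An argument set from `X.fin` lies in `Nfv`, so the variable and expansion clauses are those of
`Y` with one more argument. -/
theorem isSaturated_impl {X Y : ResSpace} (hX : X.IsSaturated) (hY : Y.IsSaturated) :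
    (X.impl Y).IsSaturated where
  isFinitenessSpace := isFinitenessSpace_impl hY.isFinitenessSpace
  varSets_subset := by
    rintro _ ⟨x, es, hes, rfl⟩
    refine (mem_impl_fin hY.isFinitenessSpace).2 fun e he => hY.varSets_subset ?_
    refine ⟨x, es ++ [e], ?_, (appsSet_append_singleton _ _ _).symm⟩
    intro e' he'
    rcases List.mem_append.1 he' with h | h
    · exact hes e' h
    · rw [List.mem_singleton.1 h]; exact hX.subset_nfv he
  subset_nfv := by
    intro g hg
    -- `prom ∅` contains only the empty poly-term, and `s ↦ app s 0` embeds `g` while preserving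
    -- reduction and free variables.
    have h := mem_nfv.1 (hY.subset_nfv (hg.2 ∅ hX.isFinitenessSpace.empty_mem))
    have hs : ∀ s ∈ g, app s 0 ∈ appSet g (prom ∅) := fun s hs => ⟨s, hs, 0, by simp [prom], rfl⟩
    refine mem_nfv.2 ⟨fun t => ?_, h.2.subset fun x hx => ?_⟩
    · refine Set.Finite.of_finite_image (f := fun s => app s 0) ((h.1 (app t 0)).subset ?_)
        fun s _ s' _ hss => (app_inj.1 hss).1
      rintro _ ⟨s, h', rfl⟩
      exact ⟨hs s h'.1, h'.2.appL 0⟩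
    · obtain ⟨s, hsg, hx⟩ := mem_fvs.1 hx
      exact mem_fvs.2 ⟨_, hs s hsg, by simp [hx]⟩
  expansion := by
    intro g hg e he es hes h
    refine (mem_impl_fin hY.isFinitenessSpace).2 fun e' he' => ?_
    have h' := h.2 e' he'
    rw [← appsSet_append_singleton] at h' ⊢
    refine hY.expansion g hg e he _ ?_ h'
    intro e'' he''
    rcases List.mem_append.1 he'' with h | h
    · exact hes e'' h
    · rw [List.mem_singleton.1 h]; exact hX.subset_nfv he'

theorem isSaturated_interSat {F : ResSpace → ResSpace}
    (hF : ∀ X : ResSpace, X.IsSaturated → (F X).IsSaturated) : (interSat F).IsSaturated where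
  isFinitenessSpace := by
    refine ⟨fun e he t ht X hX => (he X hX).2 ht, fun e he X hX => ?_⟩
    have h1 : e ⊆ (F X).web := fun t ht => he.1 ht X hX
    refine ⟨(hF X hX).isFinitenessSpace.2 ⟨h1, fun e' he' => ?_⟩, h1⟩
    -- The web of the intersection may be smaller than that of `F X`, so `e'` is first cut down to
    -- it.
    have h2 : e' ∩ (interSat F).web ∈ orth (interSat F).web (interSat F).fin := by
      refine ⟨Set.inter_subset_right, fun f hf => (he'.2 f (hf X hX).1).subset ?_⟩
      exact Set.inter_subset_inter_right _ Set.inter_subset_left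
    refine (he.2 _ h2).subset ?_
    rintro t ⟨ht, ht'⟩
    exact ⟨⟨ht, he.1 ht'⟩, ht'⟩
  varSets_subset := fun f hf X hX =>
    have h := (hF X hX).varSets_subset hf
    ⟨h, (hF X hX).isFinitenessSpace.1 f h⟩
  -- The intersection is over a nonempty family because `nfvSpace` is saturated.
  subset_nfv := fun _ he =>
    (hF _ isSaturated_nfvSpace).subset_nfv (he _ isSaturated_nfvSpace).1
  expansion := fun g hg e he es hes h X hX =>
    have h' := (hF X hX).expansion g hg e he es hes (h X hX).1
    ⟨h', (hF X hX).isFinitenessSpace.1 _ h'⟩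

end ResSpace

/-! ### Interpretation of types -/

namespace Ty

theorem isSaturated_sem (A : Ty) : ∀ I : ℕ → ResSpace, (∀ i, (I i).IsSaturated) →
    (A.sem I).IsSaturated := by
  induction A with
  | var i => exact fun I hI => hI i
  | impl A B ihA ihB => exact fun I hI => ResSpace.isSaturated_impl (ihA I hI) (ihB I hI)
  | all A ih =>
    refine fun I hI => ResSpace.isSaturated_interSat fun X hX => ih _ ?_
    rintro (_ | i)
    · exact hX
    · exact hI i

theorem sem_rename (A : Ty) : ∀ (f : ℕ → ℕ) (I : ℕ → ResSpace),
    (A.rename f).sem I = A.sem fun i => I (f i) := by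
  induction A with
  | var i => exact fun f I => rfl
  | impl A B ihA ihB => intro f I; simp only [rename, sem, ihA, ihB]
  | all A ih =>
    intro f I
    simp only [rename, sem, ih]
    congr! 3 with X
    funext i
    cases i <;> rfl

theorem sem_subst (A : Ty) : ∀ (σ : ℕ → Ty) (I : ℕ → ResSpace),
    (A.subst σ).sem I = A.sem fun i => (σ i).sem I := by
  induction A with
  | var i => exact fun f I => rfl
  | impl A B ihA ihB => intro f I; simp only [subst, sem, ihA, ihB]
  | all A ih =>
    intro σ I
    simp only [subst, sem, ih]
    congr! 3 with X
    funext i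
    cases i with
    | zero => rfl
    | succ i => exact sem_rename _ _ _

theorem sem_inst (A B : Ty) (I : ℕ → ResSpace) :
    (A.inst B).sem I = A.sem (scons (B.sem I) I) := by
  rw [inst, sem_subst]
  congr 1
  funext i
  cases i <;> rfl

end Ty

namespace RTerm

/-! ### Parallel substitution in sets -/

theorem subEnv_succ_zero {n : ℕ} (v : RTerm) :
    subEnv (n + 1) 0 (Fin.cons (α := fun _ => RPoly) {v} (0 : Fin n → RPoly)) v := by
  simp only [subEnv, Nat.succ_pos, dif_pos]
  funext i
  induction i using Fin.cases with
  | zero => simp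
  | succ i => simp [Fin.ext_iff]

theorem subEnv_succ_succ {n x : ℕ} {S : Fin n → RPoly} {v : RTerm} (h : subEnv n x S v) :
    subEnv (n + 1) (x + 1) (Fin.cons (α := fun _ => RPoly) 0 S) v := by
  unfold subEnv at h ⊢
  split_ifs at h with hx
  · subst h
    rw [dif_pos (Nat.succ_lt_succ hx)]
    funext i
    induction i using Fin.cases with
    | zero => simp [Fin.ext_iff]
    | succ i => simp [Pi.single_apply, Fin.ext_iff]
  · obtain ⟨rfl, rfl⟩ := h
    rw [dif_neg fun h => hx (Nat.lt_of_succ_lt_succ h)]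
    refine ⟨?_, by simp⟩
    funext i
    induction i using Fin.cases with
    | zero => rfl
    | succ i => rfl

theorem cons_add_cons {n : ℕ} (S T : RPoly) (Ss Ts : Fin n → RPoly) :
    (Fin.cons (S + T) (Ss + Ts) : Fin (n + 1) → RPoly) =
      (Fin.cons S Ss : Fin (n + 1) → RPoly) + (Fin.cons T Ts : Fin (n + 1) → RPoly) := by
  funext i
  induction i using Fin.cases with
  | zero => rfl
  | succ i => rfl

theorem cons_zero_zero {n : ℕ} :
    (Fin.cons (0 : RPoly) (0 : Fin n → RPoly) : Fin (n + 1) → RPoly) = 0 := by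
  funext i
  induction i using Fin.cases with
  | zero => rfl
  | succ i => rfl

theorem mem_msubstSet {n : ℕ} {f : Set RTerm} {e : Fin n → Set RTerm} {t : RTerm} :
    (t ∈ msubstSet f fun i => prom (e i)) ↔
      ∃ s ∈ f, ∃ S : Fin n → RPoly, (∀ i, S i ∈ prom (e i)) ∧ Fill s (subEnv n) S t := by
  simp only [msubstSet, mem_msubst]
  rfl

/-- Parallel substitution in the body of an abstraction: the variable `0` is left unchanged. -/
def bodySubstSet {n : ℕ} (f : Set RTerm) (e : Fin n → Set RTerm) : Set RTerm :=
  {t | ∃ s ∈ f, ∃ S : Fin n → RPoly, (∀ i, S i ∈ prom (e i)) ∧ Fill s (liftEnv (subEnv n)) S t}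

theorem msubstSet_lamSet {n : ℕ} (f : Set RTerm) (e : Fin n → Set RTerm) :
    (msubstSet (lamSet f) fun i => prom (e i)) = lamSet (bodySubstSet f e) := by
  ext t
  rw [mem_msubstSet]
  constructor
  · rintro ⟨_, ⟨s, hs, rfl⟩, S, hS, h⟩
    obtain ⟨v, hv, rfl⟩ := (fill_lam _ _ _ _).1 h
    exact ⟨v, ⟨s, hs, S, hS, hv⟩, rfl⟩
  · rintro ⟨v, ⟨s, hs, S, hS, h⟩, rfl⟩
    exact ⟨_, ⟨s, hs, rfl⟩, S, hS, (fill_lam _ _ _ _).2 ⟨v, h, rfl⟩⟩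

/-- Resources are shared out between head and arguments, and every share still has its elements in
`e i`. -/
theorem msubstSet_appSet_subset {n : ℕ} (f : Set RTerm) {ι : Type*} (I : Finset ι)
    (g : ι → Set RTerm) (e : Fin n → Set RTerm) :
    (msubstSet (appSet f (prom (⋃ j ∈ I, g j))) fun i => prom (e i)) ⊆
      appSet (msubstSet f fun i => prom (e i))
        (prom (⋃ j ∈ I, msubstSet (g j) fun i => prom (e i))) := by
  intro t ht
  obtain ⟨_, ⟨s, hs, U, hU, rfl⟩, S, hS, h⟩ := mem_msubstSet.1 ht
  obtain ⟨b, w, d, W, hw, hW, rfl, rfl⟩ := (fill_app _ _ _ _ _).1 h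
  refine ⟨w, mem_msubstSet.2 ⟨s, hs, b, fun i r hr => hS i r (Multiset.mem_add.2 (.inl hr)), hw⟩,
    W, fun r hr => ?_, rfl⟩
  obtain ⟨u, hu, b', d', hf, rfl⟩ := hW.exists_of_mem hr
  obtain ⟨j, hj, huj⟩ := Set.mem_iUnion₂.1 (hU u hu)
  refine Set.mem_iUnion₂.2 ⟨j, hj, mem_msubstSet.2 ⟨u, huj, b', fun i r hr => ?_, hf⟩⟩
  exact hS i r (Multiset.mem_add.2 (.inr (Multiset.mem_add.2 (.inl hr))))

theorem msubstSet_var_subset {n : ℕ} (i : Fin n) (e : Fin n → Set RTerm) :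
    (msubstSet {var i} fun i => prom (e i)) ⊆ e i := by
  intro t ht
  obtain ⟨_, rfl, S, hS, h⟩ := mem_msubstSet.1 ht
  have h := (fill_var _ _ _ _).1 h
  simp only [subEnv, i.2, dif_pos] at h
  subst h
  exact hS i t (by simp)

/-- Values inserted under the binder are shifted, hence free of the variable `0`. The later
substitution for `0` leaves them unchanged, so both stages merge into one parallel substitution. -/
theorem msubstSet_bodySubstSet_subset {n : ℕ} (f : Set RTerm) (e : Fin n → Set RTerm)
    (e₀ : Set RTerm) : (msubstSet (bodySubstSet f e) fun _ : Fin 1 => prom e₀) ⊆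
      msubstSet f fun i => prom ((Fin.cons e₀ e : Fin (n + 1) → Set RTerm) i) := by
  rintro w ⟨v, ⟨s, hs, S, hS, h⟩, R, hR, hw⟩
  obtain ⟨R, rfl⟩ : ∃ R₀, R = fun _ => R₀ :=
    ⟨R 0, funext fun i => by rw [Subsingleton.elim i 0]⟩
  rw [mem_msubst_one] at hw
  obtain ⟨_, rfl, h'⟩ := ((fill_compEnv s (liftEnv (subEnv n)) betaEnv (S, R) w).2 ⟨v, h, hw⟩).sim
    (Φ := fun p q => q = (Fin.cons p.2 p.1 : Fin (n + 1) → RPoly)) (d := subEnv (n + 1))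
    cons_zero_zero.symm (by rintro ⟨p, p'⟩ _ ⟨q, q'⟩ _ rfl rfl; exact (cons_add_cons _ _ _ _).symm)
    (by
      rintro (_ | x) _ ⟨S, R⟩ w ⟨z, hz, hw⟩
      · obtain ⟨h1, rfl⟩ := hz
        obtain rfl : S = 0 := h1
        obtain rfl : R = {w} := (fill_var _ _ _ _).1 hw
        exact ⟨_, rfl, subEnv_succ_zero w⟩
      · obtain ⟨z, hz, rfl⟩ := hz
        obtain ⟨h1, rfl⟩ := fill_rename_succ_betaEnv.1 hw
        obtain rfl : R = 0 := h1
        exact ⟨_, rfl, subEnv_succ_succ hz⟩)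
  refine mem_msubstSet.2 ⟨s, hs, _, fun i => ?_, h'⟩
  induction i using Fin.cases with
  | zero => exact hR 0
  | succ i => exact hS i

/-- The renaming which gives the name `y` to the variable `0` of the body of an abstraction. -/
def openRen (y : ℕ) : ℕ → ℕ
  | 0 => y
  | k + 1 => k

theorem rename_openRen_mem {n : ℕ} {f : Set RTerm} {e : Fin n → Set RTerm} (y : ℕ) {v : RTerm}
    (hv : v ∈ bodySubstSet f e) : rename v (openRen y) ∈
      msubstSet f fun i => prom ((Fin.cons {var y} e : Fin (n + 1) → Set RTerm) i) := by
  obtain ⟨s, hs, S, hS, h⟩ := hv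
  obtain ⟨T, ⟨hT, rfl⟩, h'⟩ :=
    ((fill_renEnv s (openRen y) (liftEnv (subEnv n)) S _).2 ⟨v, h, rfl⟩).sim
    -- The number of copies of `var y` is left free: it is whatever number of occurrences of `0`
    -- there is.
    (Φ := fun S (T : Fin (n + 1) → RPoly) => T 0 ∈ prom {var y} ∧ S = fun i => T i.succ)
    (d := subEnv (n + 1)) ⟨by simp [prom], rfl⟩
    (by
      rintro _ a _ b ⟨h1, rfl⟩ ⟨h2, rfl⟩
      exact ⟨fun t ht => (Multiset.mem_add.1 ht).elim (h1 t) (h2 t), rfl⟩)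
    (by
      rintro (_ | x) _ S w ⟨z, hz, rfl⟩
      · obtain ⟨rfl, rfl⟩ := hz
        rw [rename_var]
        exact ⟨_, ⟨by simp [prom, openRen], rfl⟩, subEnv_succ_zero _⟩
      · obtain ⟨z, hz, rfl⟩ := hz
        have hz' : rename (rename z Nat.succ) (openRen y) = z := by
          rw [rename_rename]
          exact rename_eq_self _ _ fun _ _ => rfl
        rw [hz']
        exact ⟨_, ⟨by simp [prom], rfl⟩, subEnv_succ_succ hz⟩)
  refine mem_msubstSet.2 ⟨s, hs, T, fun i => ?_, h'⟩
  induction i using Fin.cases with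
  | zero => exact hT
  | succ i => exact hS i

theorem fvs_bodySubstSet_subset {n : ℕ} {f : Set RTerm} (hf : ∀ s ∈ f, ∀ x ∈ fv s, x < n + 1)
    (e : Fin n → Set RTerm) {x : ℕ} (hx : x + 1 ∈ fvs (bodySubstSet f e)) : ∃ i, x ∈ fvs (e i) := by
  obtain ⟨v, ⟨s, hs, S, hS, h⟩, hx⟩ := mem_fvs.1 hx
  obtain ⟨z, hz, b, d, w, rfl, hc, hw⟩ := h.exists_of_mem_fv hx
  cases z with
  | zero =>
    obtain ⟨_, rfl⟩ := hc
    simp at hw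
  | succ z =>
    obtain ⟨w, hc, rfl⟩ := hc
    obtain ⟨x', hx', hxx⟩ := exists_of_mem_fv_rename _ _ hw
    obtain rfl := Nat.succ_injective hxx
    have hzn : z < n := Nat.lt_of_succ_lt_succ (hf s hs _ hz)
    simp only [subEnv, hzn, dif_pos] at hc
    subst hc
    exact ⟨⟨z, hzn⟩, mem_fvs.2 ⟨w, hS _ w (by simp), hx'⟩⟩

/-- Reduction is stable under renaming `0` to a `y` not free in any `e i`. Such a renaming is
invertible on these bodies, whose free variables other than `0` all come from the `e i`, so
finiteness transfers back. -/
theorem bodySubstSet_mem_nfv {n : ℕ} {f : Set RTerm} (hf : ∀ s ∈ f, ∀ x ∈ fv s, x < n + 1)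
    {e : Fin n → Set RTerm} (he : ∀ i, e i ∈ Nfv)
    (h : ∀ y, (msubstSet f fun i => prom ((Fin.cons {var y} e : Fin (n + 1) → Set RTerm) i)) ∈ Nfv) :
    bodySubstSet f e ∈ Nfv := by
  have hfin : (⋃ i, fvs (e i)).Finite := Set.finite_iUnion fun i => (mem_nfv.1 (he i)).2
  obtain ⟨y, hy⟩ := hfin.exists_notMem
  have hg := mem_nfv.1 (h y)
  refine mem_nfv.2 ⟨fun t => ?_, ?_⟩
  · refine ((hg.1 (rename t (openRen y))).image
      fun v => rename v fun z => if z = y then 0 else z + 1).subset ?_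
    rintro v ⟨hv, ht⟩
    refine ⟨_, ⟨rename_openRen_mem y hv, ht.rename _⟩, ?_⟩
    simp only [rename_rename]
    refine rename_eq_self _ _ fun k hk => ?_
    cases k with
    | zero => simp [openRen]
    | succ k =>
      obtain ⟨i, hi⟩ := fvs_bodySubstSet_subset hf e (mem_fvs.2 ⟨v, hv, hk⟩)
      have hky : k ≠ y := fun h => hy (h ▸ Set.mem_iUnion.2 ⟨i, hi⟩)
      simp [openRen, hky]
  · refine ((hfin.image Nat.succ).union (Set.finite_singleton 0)).subset ?_
    rintro (_ | x) hx
    · exact .inr rfl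
    · obtain ⟨i, hi⟩ := fvs_bodySubstSet_subset hf e hx
      exact .inl ⟨x, Set.mem_iUnion.2 ⟨i, hi⟩, rfl⟩

theorem subset_msubstSet_var {n : ℕ} {f : Set RTerm} (hf : ∀ s ∈ f, ∀ x ∈ fv s, x < n) :
    f ⊆ msubstSet f fun i : Fin n => prom {var i} := by
  intro s hs
  -- The label `0` in `ℕ` is a dummy. The bound on free variables ensures that no variable is
  -- shifted down by `n`.
  obtain ⟨S, hS, h⟩ := ((fill_idEnv s (0 : ℕ) s).2 ⟨rfl, rfl⟩).sim
    (Φ := fun _ (S : Fin n → RPoly) => ∀ i : Fin n, S i ∈ prom {var i}) (d := subEnv n)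
    (by simp [prom])
    (by
      intro _ S _ T hS hT i t ht
      exact (Multiset.mem_add.1 ht).elim (hS i t) (hT i t))
    (by
      rintro x hx a v ⟨rfl, rfl⟩
      refine ⟨Pi.single ⟨x, hf s hs x hx⟩ {var x}, fun i t ht => ?_, ?_⟩
      · by_cases hi : i = ⟨x, hf s hs x hx⟩
        · subst hi
          simpa using ht
        · simp [hi] at ht
      · simp [subEnv, hf s hs x hx])
  exact mem_msubstSet.2 ⟨s, hs, S, hS, h⟩

end RTerm

/-! ### Soundness of typing, and the support of the Taylor expansion. -/

namespace AlgTerm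

variable {K : Type u} [Field K]

theorem Typed.lt_of_mem_fv_shape {n : ℕ} {Γ : Fin n → Ty} {M : AlgTerm K} {A : Ty}
    (hM : Typed Γ M A) : ∀ s ∈ M.shape, ∀ x ∈ fv s, x < n := by
  induction hM with
  | var Γ i =>
    rw [shape_var]
    rintro _ rfl x hx
    obtain rfl : x = i := by simpa using hx
    exact i.2
  | lam _ ih =>
    rw [shape_lam]
    rintro _ ⟨s, hs, rfl⟩ x hx
    exact Nat.lt_of_succ_lt_succ (ih s hs (x + 1) (by simpa using hx))
  | app _ _ ih ihQ =>
    rw [shape_app]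
    rintro _ ⟨s, hs, S, hS, rfl⟩ x hx
    rw [fv_app] at hx
    rcases hx with hx | ⟨t, ht, hx⟩
    · exact ih s hs x hx
    · obtain ⟨N, hN, ht⟩ := Set.mem_iUnion₂.1 (hS t ht)
      exact ihQ N hN t ht x hx
  | inst _ _ ih => exact ih
  | gen _ ih => exact ih

/-- Application uses closure under finite unions, abstraction uses expansion with no further
argument, and the quantifier rules use that types denote saturated spaces. -/
theorem Typed.msubstSet_shape_mem {n : ℕ} {Γ : Fin n → Ty} {M : AlgTerm K} {A : Ty}
    (hM : Typed Γ M A) : ∀ I : ℕ → ResSpace, (∀ φ, (I φ).IsSaturated) →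
      ∀ e : Fin n → Set RTerm, (∀ i, e i ∈ ((Γ i).sem I).fin) →
        (msubstSet M.shape fun i => prom (e i)) ∈ (A.sem I).fin := by
  induction hM with
  | var Γ i =>
    intro I hI e he
    rw [shape_var]
    exact ((Γ i).isSaturated_sem I hI).isFinitenessSpace.mem_of_subset (he i)
      (msubstSet_var_subset i e)
  | @lam n Γ M A B hM ih =>
    intro I hI e he
    have hA := A.isSaturated_sem I hI
    have hB := B.isSaturated_sem I hI
    have heN : ∀ i, e i ∈ Nfv := fun i => ((Γ i).isSaturated_sem I hI).subset_nfv (he i)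
    have key : ∀ e₀ ∈ (A.sem I).fin, (msubstSet M.shape fun i =>
        prom ((Fin.cons e₀ e : Fin (n + 1) → Set RTerm) i)) ∈ (B.sem I).fin := by
      refine fun e₀ he₀ => ih I hI _ fun i => ?_
      induction i using Fin.cases with
      | zero => exact he₀
      | succ i => exact he i
    rw [shape_lam, msubstSet_lamSet]
    refine (ResSpace.mem_impl_fin hB.isFinitenessSpace).2 fun e₀ he₀ => ?_
    refine hB.expansion _ (bodySubstSet_mem_nfv hM.lt_of_mem_fv_shape heN fun y => ?_) e₀
      (hA.subset_nfv he₀) [] (by simp) (hB.isFinitenessSpace.mem_of_subset (key e₀ he₀)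
        (msubstSet_bodySubstSet_subset _ _ _))
    -- A saturated space contains every `{var y}`, so the bound variable can be named by any `y`.
    exact hB.subset_nfv (key _ (hA.varSets_subset ⟨y, [], by simp, rfl⟩))
  | @app n Γ M Q A B _ _ ih ihQ =>
    intro I hI e he
    have hA := A.isSaturated_sem I hI
    have hB := B.isSaturated_sem I hI
    rw [shape_app]
    exact hB.isFinitenessSpace.mem_of_subset ((ih I hI e he).2 _
      (hA.isFinitenessSpace.finite_union_mem Q.support fun N hN => ihQ N hN I hI e he))
      (msubstSet_appSet_subset _ _ _ _)
  | inst B _ ih =>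
    intro I hI e he
    rw [Ty.sem_inst]
    exact (ih I hI e he _ (B.isSaturated_sem I hI)).1
  | @gen n Γ M A _ ih =>
    intro I hI e he X hX
    have hI' : ∀ i, (scons X I i).IsSaturated := by
      rintro (_ | i)
      · exact hX
      · exact hI i
    have h := ih (scons X I) hI' e fun i => by
      rw [Ty.sem_rename]
      exact he i
    exact ⟨h, (A.isSaturated_sem _ hI').isFinitenessSpace.1 _ h⟩

/-- Adequacy at the constant valuation `nfvSpace`, with each variable substituted for itself. -/
theorem Typed.shape_mem_nfv {n : ℕ} {Γ : Fin n → Ty} {M : AlgTerm K} {A : Ty}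
    (hM : Typed Γ M A) : M.shape ∈ Nfv := by
  have hI : ∀ _ : ℕ, ResSpace.nfvSpace.IsSaturated := fun _ => ResSpace.isSaturated_nfvSpace
  refine mem_nfv_of_subset ((A.isSaturated_sem _ hI).subset_nfv
    (hM.msubstSet_shape_mem _ hI (fun i => {RTerm.var i}) fun i => ?_))
    (subset_msubstSet_var hM.lt_of_mem_fv_shape)
  exact ((Γ i).isSaturated_sem _ hI).varSets_subset ⟨i, [], by simp, rfl⟩

/-- At an application, a nonzero product of powers forces every element of the argument to have a
nonzero coefficient in the expansion of `Q`, hence in that of some summand. -/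
theorem support_taylor_subset (M : AlgTerm K) : Function.support M.taylor ⊆ M.shape := by
  induction M using ind with
  | hvar x =>
    intro s hs
    rw [Function.mem_support, taylor_var] at hs
    rw [shape_var]
    by_contra h
    exact hs (if_neg h)
  | hlam M ih =>
    intro s hs
    rw [shape_lam]
    induction s using RTerm.ind with
    | hvar x => simp [taylor, fold_lam, taylorStep] at hs
    | hlam s => exact ⟨s, ih (by rwa [Function.mem_support, taylor_lam_lam] at hs), rfl⟩
    | happ s S => simp [taylor, fold_lam, taylorStep] at hs
  | happ M Q ih ihQ =>
    intro s hs
    rw [shape_app]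
    induction s using RTerm.ind with
    | hvar x => simp [taylor, fold_app, taylorStep] at hs
    | hlam s => simp [taylor, fold_app, taylorStep] at hs
    | happ s S =>
      rw [Function.mem_support, taylor_app_app] at hs
      refine ⟨s, ih (left_ne_zero_of_mul hs), S, fun t ht => ?_, rfl⟩
      have h := Finset.prod_ne_zero_iff.1 (right_ne_zero_of_mul hs) t (by simpa using ht)
      have h' : (Q.sum fun N c => c * taylor N t) ≠ 0 := by
        intro h0
        rw [h0, zero_pow (Multiset.count_ne_zero.2 ht), zero_div] at h
        exact h rfl
      obtain ⟨N, hN, hNt⟩ := Finset.exists_ne_zero_of_sum_ne_zero h'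
      exact Set.mem_iUnion₂.2 ⟨N, hN, ihQ N hN (right_ne_zero_of_mul hNt)⟩

end AlgTerm

/-- Reducts of the elements of a set of `Nfv`. -/
theorem finite_and_mem_nfv_of_red {e : Set RTerm} (he : e ∈ Nfv) {a : RTerm → Multiset RTerm}
    (ha : ∀ s ∈ e, Red {s} (a s)) :
    (∀ t, {s | s ∈ e ∧ t ∈ a s}.Finite) ∧ {t | ∃ s ∈ e, t ∈ a s} ∈ Nfv := by
  obtain ⟨h1, h2⟩ := mem_nfv.1 he
  have hb : ∀ s ∈ e, ∀ t ∈ a s, Below t s := fun s hs t ht => ⟨a s, ha s hs, ht⟩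
  refine ⟨fun t => (h1 t).subset fun s hs => ⟨hs.1, hb s hs.1 t hs.2⟩, mem_nfv.2 ⟨fun u => ?_, ?_⟩⟩
  -- By transitivity, a reduct above `u` comes from a term of `e` above `u`; there are finitely many
  -- of these, each with finitely many reducts in `a s`.
  · refine ((h1 u).biUnion fun s _ => (a s).toFinset.finite_toSet).subset ?_
    rintro t ⟨⟨s, hs, ht⟩, hu⟩
    exact Set.mem_biUnion (x := s) ⟨hs, hu.trans (hb s hs t ht)⟩ (by simpa using ht)
  · refine h2.subset fun x hx => ?_
    obtain ⟨t, ⟨s, hs, ht⟩, hx⟩ := mem_fvs.1 hx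
    exact mem_fvs.2 ⟨s, hs, (hb s hs t ht).fv_subset hx⟩

theorem mainTheorem1 {K : Type*} [Field K] {n : ℕ} (A : Fin n → Ty) (M : AlgTerm K) (B : Ty)
    (hM : AlgTerm.Typed A M B) :
    (∀ I : ℕ → ResSpace, (∀ φ, (I φ).IsSaturated) →
      ∀ e : Fin n → Set RTerm, (∀ i, e i ∈ ((A i).sem I).fin) →
        msubstSet M.shape (fun i => prom (e i)) ∈ (B.sem I).fin) ∧
    (CharZero K →
      M.taylor ∈ vectors K Nfv ∧
      ∀ a : RTerm → Multiset RTerm, (∀ s, M.taylor s ≠ 0 → RTerm.Red {s} (a s)) →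
        (∀ t, {s | M.taylor s ≠ 0 ∧ t ∈ a s}.Finite) ∧
        (fun t => ∑ᶠ s, M.taylor s * ((a s).count t : K)) ∈ vectors K Nfv) := by
  have hN : Function.support M.taylor ∈ Nfv :=
    mem_nfv_of_subset hM.shape_mem_nfv M.support_taylor_subset
  refine ⟨hM.msubstSet_shape_mem, fun _ => ⟨hN, fun a ha => ?_⟩⟩
  obtain ⟨h1, h2⟩ := finite_and_mem_nfv_of_red hN ha
  refine ⟨h1, mem_nfv_of_subset h2 fun t ht => ?_⟩
  -- A nonzero sum has a nonzero term, so its support lies among the chosen reducts of terms in the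
  -- support of `M.taylor`.
  obtain ⟨s, hs⟩ : ∃ s, M.taylor s * ((a s).count t : K) ≠ 0 := by
    by_contra! h
    exact ht (by simp [h])
  refine ⟨s, left_ne_zero_of_mul hs, ?_⟩
  by_contra h
  simp [Multiset.count_eq_zero_of_notMem h] at hs
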